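/- There is an absolute constant $K>0$ with the following property. For $\mathfrak a\in\{0,1\}$, $c>0$ and $x>0$ put $$W_{\mathfrak a}(x)=\frac1{2\pi i}\int_{c-i\infty}^{c+i\infty}\left(\frac{\Gamma\big(\frac{s+\frac12+\mathfrak a}{2}\big)}{\Gamma\big(\frac{\frac12+\mathfrak a}{2}\big)}\right)^2x^{-s}\,\frac{ds}{s};$$ this integral converges absolutely, and the assertions below hold, with the same $K$, for every choice of $c>0$. Let $q\ge 2$ be an integer, let $\varphi(q)$ be Euler's function and $\omega(q)$ the number of distinct prime factors of $q$, and let $Z=q/2^{\omega(q)}$. For a Dirichlet character $\chi$ mod $q$ (not necessarily primitive) define $\mathfrak a\in\{0,1\}$ by $\chi(-1)=(-1)^{\mathfrak a}$. Then for every $\chi$ mod $q$ the series $$A(\chi)=\sum_{a,b\ge1}\frac{\chi(a)\overline{\chi}(b)}{\sqrt{ab}}\,W_{\mathfrak a}\Big(\frac{\pi ab}{q}\Big)$$ converges absolutely, and its tail $$C(\chi)=\sum_{\substack{a,b\ge1\\ ab>Z}}\frac{\chi(a)\overline{\chi}(b)}{\sqrt{ab}}\,W_{\mathfrak a}\Big(\frac{\pi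 ab}{q}\Big)$$ satisfies $$\sum_{\chi \bmod q}|C(\chi)|^2\le K\left(q\Big(\frac{\varphi(q)}{q}\Big)^5\big(\omega(q)\log q\big)^2+q(\log q)^3\right),$$ where the sum runs over all characters mod $q$. -/

import Mathlib

noncomputable section

namespace CharTail

/-- The integrand `(Γ((s + 1/2 + a)/2) / Γ((1/2 + a)/2))² / s`, without the factor `x ^ (-s)`. -/
def weightKernel (a : ℕ) (s : ℂ) : ℂ :=
  (Complex.Gamma ((s + 1 / 2 + (a : ℂ)) / 2) / Complex.Gamma ((1 / 2 + (a : ℂ)) / 2)) ^ 2 / s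

/-- The weight `W_a(x) = (1/2πi) ∫_{c-i∞}^{c+i∞} (Γ((s+1/2+a)/2) / Γ((1/2+a)/2))² x^{-s} ds/s`,
taken on the line `Re s = c`. Note that `mellinInv c f x` is `(1/2π) ∫ x^{-(c+iy)} f(c+iy) dy`
over the real line, which is the contour integral since `ds = i dy`. -/
def weight (c : ℝ) (a : ℕ) (x : ℝ) : ℂ :=
  mellinInv c (weightKernel a) x

open Classical in
/-- The number `a ∈ {0, 1}` with `χ(-1) = (-1)^a`. -/
def parity {q : ℕ} (χ : DirichletCharacter ℂ q) : ℕ :=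
  if χ (-1) = 1 then 0 else 1

/-- `Z = q / 2^{ω(q)}`. -/
def cutoff (q : ℕ) : ℝ :=
  (q : ℝ) / 2 ^ ArithmeticFunction.cardDistinctFactors q

/-- The term `χ(a) χ̄(b) (ab)^{-1/2} W_𝔞(π a b / q)`. -/
def summand (c : ℝ) {q : ℕ} (χ : DirichletCharacter ℂ q) (p : ℕ+ × ℕ+) : ℂ :=
  χ ((p.1 : ℕ) : ZMod q) * (starRingEnd ℂ) (χ ((p.2 : ℕ) : ZMod q)) /
      (Real.sqrt ((p.1 : ℝ) * (p.2 : ℝ)) : ℂ) *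
    weight c (parity χ) (Real.pi * ((p.1 : ℝ) * (p.2 : ℝ)) / (q : ℝ))

/-- The pairs `(a, b)` of positive integers with `ab > Z`. -/
def tailPairs (q : ℕ) : Set (ℕ+ × ℕ+) :=
  {p | cutoff q < (p.1 : ℝ) * (p.2 : ℝ)}

/-- `C(χ)`, the sum of the terms with `ab > Z`. -/
def tailSum (c : ℝ) {q : ℕ} (χ : DirichletCharacter ℂ q) : ℂ :=
  ∑' p : tailPairs q, summand c χ p

end CharTail

end

/-!
The weight is real and has an explicit description: if `u`, `v` are independent Gamma variables of
shape `(1/2 + 𝔞)/2`, then `E[(uv)^(s/2)]` is the squared Gamma quotient, so the Mellin transform of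
`x ↦ P(x < √(uv))` is `weightKernel 𝔞 s` on `Re s > 0`. Mellin inversion (`weight_eq_survival`)
therefore identifies `W_𝔞(x)` with this probability for every `c > 0`; in particular it does not
depend on `c`, lies in `[0, 1]` and is `O(x⁻³)`. So the coefficient of `χ(a) χ̄(b)` is at most a
constant times `majorant q (a, b) = min(1, q/(ab))³ / √(ab)`.

For the mean square, `C(χ)` is split into the parts with `b ≤ a` and `a < b`. Exchanging `a` and `b`
amounts to complex conjugation, so it suffices to treat `b ≤ a`. Orthogonality
(`sum_norm_sq_pairSum`) turns the mean square into `φ(q)` times a sum over quadruples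
`(a, b), (c, d)` coprime to `q` with `ad ≡ bc (mod q)`.

* Diagonal terms `ad = bc` (`diagonal_le`): write `(a, b) = h (r, s)` and `(c, d) = g (r, s)` with
  `r`, `s` coprime. The sum is at most `∑ 1/(rs) S(rs)²`, where `S(n)` sums `1/g` over `g` coprime
  to `q` in the window `q/2^ω(q) < g² n ≲ q`, and `S(n) = O(ω(q) φ(q)/q)`. Indeed the part of the
  window beyond `4^ω(q)` consists of `O(ω(q))` dyadic blocks, each contributing `O(φ(q)/q)` by
  Legendre's sieve (`sum_coprime_Ioc_le`), and the `g ≤ y = 4^ω(q)` are handled by comparison with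
  the Euler product of `ζ` at `1 + 1/(2 log y)` (`sum_coprime_rpow_le`). The same comparison bounds
  the sums over `r` and `s` by `O(φ(q)/q · log q)`. Together this is `O((φ(q)/q)⁴ (ω(q) log q)²)`.
* Off-diagonal terms (`offDiagonal_le`): by symmetry `ad = bc + ql` with `l ≥ 1`. For fixed
  `b, d, l` the variable `c` lies in one residue class modulo `d / gcd(b, d)`, and `a` is then
  determined. Because `d ≤ c`, this class is not too sparse for the range of `c`, so the sum over
  `c` is bounded by its average, and the sums over `l`, `b`, `d` give `O(log² q)`. The restriction
  to `b ≤ a`, `d ≤ c` is what makes this work: without it, the case where `a` and `d` are both much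
  larger than `b` and `c` would require counting divisors in progressions.
-/

noncomputable section

namespace CharTail

/-! ### The weight as a survival function -/

section

open MeasureTheory ProbabilityTheory Set

/-- The Mellin transform of the survival function of a nonnegative random variable `Y` is `E[Y ^ s]
/ s`, by Fubini's theorem. -/
lemma mellin_survival {Ω : Type*} [MeasurableSpace Ω] (ν : Measure Ω) [IsProbabilityMeasure ν]
    {Y : Ω → ℝ} (hY : Measurable Y) (hY0 : ∀ ω, 0 ≤ Y ω) {s : ℂ} (hs : 0 < s.re)
    (hint : Integrable (fun ω ↦ (Y ω : ℂ) ^ s) ν) :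
    MellinConvergent (fun x ↦ ((ν.real {ω | x < Y ω} : ℝ) : ℂ)) s ∧
      mellin (fun x ↦ ((ν.real {ω | x < Y ω} : ℝ) : ℂ)) s = (∫ ω, (Y ω : ℂ) ^ s ∂ν) / s := by
  set G : ℝ × Ω → ℂ := fun p ↦ {p : ℝ × Ω | p.1 < Y p.2}.indicator (fun p ↦ (p.1 : ℂ) ^ (s - 1)) p
  have hGm : Measurable G := by
    refine Measurable.indicator (by fun_prop) (measurableSet_lt (by fun_prop) (by fun_prop))
  have hG (ω : Ω) : (fun x ↦ G (x, ω)) = (Iio (Y ω)).indicator (fun x : ℝ ↦ (x : ℂ) ^ (s - 1)) := by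
    ext x
    simp [G, indicator]
  have hset (y : ℝ) : Iio y ∩ Ioi 0 = Ioo 0 y := by
    ext; simp [and_comm]
  have hs' : -1 < (s - 1).re := by simpa using hs
  have hre : -1 < s.re - 1 := by linarith
  have hInt (ω : Ω) : Integrable (fun x ↦ G (x, ω)) (volume.restrict (Ioi 0)) := by
    rw [hG, integrable_indicator_iff measurableSet_Iio, IntegrableOn,
      Measure.restrict_restrict measurableSet_Iio, hset]
    have := intervalIntegral.intervalIntegrable_cpow' (a := 0) (b := Y ω) hs'
    rw [intervalIntegrable_iff_integrableOn_Ioo_of_le (hY0 ω)] at this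
    exact this
  have hnorm (ω : Ω) : ∫ x in Ioi 0, ‖G (x, ω)‖ = ‖(Y ω : ℂ) ^ s‖ / s.re := by
    have : (fun x ↦ ‖G (x, ω)‖) =
        (Iio (Y ω)).indicator (fun x : ℝ ↦ ‖(x : ℂ) ^ (s - 1)‖) := by
      ext x
      rw [show G (x, ω) = _ from congrFun (hG ω) x, norm_indicator_eq_indicator_norm]
    rw [this, integral_indicator measurableSet_Iio, Measure.restrict_restrict measurableSet_Iio,
      hset]
    rw [setIntegral_congr_fun (g := fun x : ℝ ↦ x ^ (s.re - 1)) measurableSet_Ioo]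
    · rw [← integral_Ioc_eq_integral_Ioo, ← intervalIntegral.integral_of_le (hY0 ω),
        integral_rpow (Or.inl hre), Complex.norm_cpow_eq_rpow_re_of_nonneg (hY0 ω) hs.ne']
      simp [Real.zero_rpow hs.ne']
    · intro x hx
      simp [Complex.norm_cpow_eq_rpow_re_of_pos hx.1]
  have hval (ω : Ω) : ∫ x in Ioi 0, G (x, ω) = (Y ω : ℂ) ^ s / s := by
    have h0 : s ≠ 0 := by rintro rfl; simp at hs
    rw [hG, integral_indicator measurableSet_Iio, Measure.restrict_restrict measurableSet_Iio,
      hset, ← integral_Ioc_eq_integral_Ioo, ← intervalIntegral.integral_of_le (hY0 ω),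
      integral_cpow (Or.inl hs')]
    simp [Complex.zero_cpow h0]
  have hprod : Integrable G ((volume.restrict (Ioi 0)).prod ν) := by
    rw [integrable_prod_iff' hGm.aestronglyMeasurable]
    refine ⟨.of_forall hInt, ?_⟩
    simp_rw [hnorm]
    exact hint.norm.div_const _
  have hfib (x : ℝ) : ∫ ω, G (x, ω) ∂ν =
      (x : ℂ) ^ (s - 1) • ((ν.real {ω | x < Y ω} : ℝ) : ℂ) := by
    have : (fun ω ↦ G (x, ω)) = {ω | x < Y ω}.indicator (fun _ ↦ (x : ℂ) ^ (s - 1)) := by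
      ext ω
      simp [G, indicator]
    rw [this, integral_indicator (measurableSet_lt (by fun_prop) hY), setIntegral_const]
    simp [mul_comm]
  constructor
  · have := hprod.integral_prod_left
    simp_rw [hfib] at this
    exact this
  · rw [mellin, ← integral_div]
    simp_rw [← hfib, ← hval]
    exact integral_integral_swap hprod

/-- Complex moments of the Gamma distribution of shape `α` and rate `1`. -/
lemma gammaMeasure_cpow {α : ℝ} (hα : 0 < α) {w : ℂ} (hw : 0 < w.re) :
    Integrable (fun t : ℝ ↦ (t : ℂ) ^ w) (gammaMeasure α 1) ∧
      ∫ t, (t : ℂ) ^ w ∂(gammaMeasure α 1) = Complex.Gamma (α + w) / Complex.Gamma α := by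
  have hm : Measurable (gammaPDF α 1) := (measurable_gammaPDFReal α 1).ennreal_ofReal
  have hlt : ∀ᵐ t : ℝ, gammaPDF α 1 t < ⊤ := .of_forall fun t ↦ ENNReal.ofReal_lt_top
  have hre : 0 < ((α : ℂ) + w).re := by simp; linarith
  have hform : (fun t : ℝ ↦ (gammaPDF α 1 t).toReal • (t : ℂ) ^ w) =ᵐ[volume]
      (Ioi 0).indicator
        (fun t : ℝ ↦ (Complex.Gamma α)⁻¹ * (((-t).exp : ℝ) * (t : ℂ) ^ ((α : ℂ) + w - 1))) := by
    filter_upwards [Measure.ae_ne volume (0 : ℝ)] with t ht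
    rcases lt_or_gt_of_ne ht with h | h
    · simp [gammaPDF_of_neg h, h.not_gt]
    · rw [gammaPDF, ENNReal.toReal_ofReal (gammaPDFReal_nonneg hα one_pos _), gammaPDFReal,
        if_pos h.le, indicator_of_mem (mem_Ioi.2 h), Complex.real_smul, Complex.Gamma_ofReal,
        show (α : ℂ) + w - 1 = ((α - 1 : ℝ) : ℂ) + w by push_cast; ring,
        Complex.cpow_add _ _ (by exact_mod_cast ht), ← Complex.ofReal_cpow h.le]
      push_cast
      simp
      ring
  have hconv := (Complex.GammaIntegral_convergent hre).const_mul (Complex.Gamma α)⁻¹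
  constructor
  · rw [gammaMeasure, integrable_withDensity_iff_integrable_smul' hm hlt, integrable_congr hform,
      integrable_indicator_iff measurableSet_Ioi]
    exact hconv
  · rw [gammaMeasure, integral_withDensity_eq_integral_toReal_smul hm hlt, integral_congr_ae hform,
      integral_indicator measurableSet_Ioi, integral_const_mul, Complex.Gamma_eq_integral hre,
      Complex.GammaIntegral, div_eq_inv_mul]

/-- The shape `(1/2 + a)/2` of the Gamma variables whose moments give the kernel `weightKernel a`.
-/
def gammaShape (a : ℕ) : ℝ := (1 / 2 + a) / 2

lemma gammaShape_pos (a : ℕ) : 0 < gammaShape a := by unfold gammaShape; positivity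

instance (a : ℕ) : IsProbabilityMeasure (gammaMeasure (gammaShape a) 1) :=
  isProbabilityMeasure_gammaMeasure (gammaShape_pos a) one_pos

/-- The law of a pair `(u, v)` of independent Gamma variables of shape `gammaShape a`. -/
def gammaPair (a : ℕ) : Measure (ℝ × ℝ) :=
  (gammaMeasure (gammaShape a) 1).prod (gammaMeasure (gammaShape a) 1)

instance (a : ℕ) : IsProbabilityMeasure (gammaPair a) := by
  unfold gammaPair; infer_instance

/-- The probability that `√(uv)` exceeds `x`, for `(u, v)` distributed as `gammaPair a`. -/
def survival (a : ℕ) (x : ℝ) : ℝ := (gammaPair a).real {p | x < √(p.1 * p.2)}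

lemma survival_nonneg (a : ℕ) (x : ℝ) : 0 ≤ survival a x := measureReal_nonneg

lemma survival_le_one (a : ℕ) (x : ℝ) : survival a x ≤ 1 := measureReal_le_one

lemma ae_pos_gammaMeasure (α : ℝ) : ∀ᵐ t ∂(gammaMeasure α 1), 0 < t := by
  have hm : Measurable (gammaPDF α 1) := (measurable_gammaPDFReal α 1).ennreal_ofReal
  rw [gammaMeasure, ae_withDensity_iff hm]
  filter_upwards [Measure.ae_ne volume (0 : ℝ)] with t ht h
  by_contra hcon
  exact h (gammaPDF_of_neg (lt_of_le_of_ne (not_lt.1 hcon) ht))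

lemma gammaPair_cpow (a : ℕ) {s : ℂ} (hs : 0 < s.re) :
    Integrable (fun p : ℝ × ℝ ↦ ((√(p.1 * p.2) : ℝ) : ℂ) ^ s) (gammaPair a) ∧
      ∫ p : ℝ × ℝ, ((√(p.1 * p.2) : ℝ) : ℂ) ^ s ∂(gammaPair a) =
        (Complex.Gamma ((s + 1 / 2 + (a : ℂ)) / 2) /
          Complex.Gamma ((1 / 2 + (a : ℂ)) / 2)) ^ 2 := by
  have hs2 : 0 < (s / 2).re := by simpa using hs
  obtain ⟨hi, hv⟩ := gammaMeasure_cpow (gammaShape_pos a) hs2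
  have hae : (fun p : ℝ × ℝ ↦ ((√(p.1 * p.2) : ℝ) : ℂ) ^ s) =ᵐ[gammaPair a]
      fun p ↦ (p.1 : ℂ) ^ (s / 2) * (p.2 : ℂ) ^ (s / 2) := by
    have h1 : ∀ᵐ p ∂(gammaPair a), 0 < p.1 :=
      Measure.quasiMeasurePreserving_fst.ae (ae_pos_gammaMeasure _)
    have h2 : ∀ᵐ p ∂(gammaPair a), 0 < p.2 :=
      Measure.quasiMeasurePreserving_snd.ae (ae_pos_gammaMeasure _)
    filter_upwards [h1, h2] with p hp1 hp2
    have hsqrt {t : ℝ} (ht : 0 < t) : ((√t : ℝ) : ℂ) ^ s = (t : ℂ) ^ (s / 2) := by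
      rw [Complex.cpow_def_of_ne_zero (by simpa using (Real.sqrt_pos.2 ht).ne'),
        Complex.cpow_def_of_ne_zero (by exact_mod_cast ht.ne'),
        ← Complex.ofReal_log (by positivity),
        ← Complex.ofReal_log ht.le, Real.log_sqrt ht.le]
      congr 1
      push_cast
      ring
    rw [Real.sqrt_mul hp1.le, Complex.ofReal_mul,
      Complex.mul_cpow_ofReal_nonneg (Real.sqrt_nonneg _) (Real.sqrt_nonneg _), hsqrt hp1,
      hsqrt hp2]
  constructor
  · exact (hi.mul_prod hi).congr hae.symm
  · rw [integral_congr_ae hae, gammaPair, integral_prod_mul (fun t : ℝ ↦ (t : ℂ) ^ (s / 2))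
      (fun t : ℝ ↦ (t : ℂ) ^ (s / 2)), hv, sq]
    congr 3 <;> simp [gammaShape] <;> ring

/-- The law of `√(uv)` has no atoms away from `0`. -/
lemma continuousAt_survival (a : ℕ) {x : ℝ} (hx : 0 < x) :
    ContinuousAt (fun y ↦ ((survival a y : ℝ) : ℂ)) x := by
  have hm : Measurable fun p : ℝ × ℝ ↦ √(p.1 * p.2) := by fun_prop
  have hnull : gammaPair a {p | √(p.1 * p.2) = x} = 0 := by
    rw [gammaPair, Measure.measure_prod_null (measurableSet_eq_fun hm measurable_const)]
    filter_upwards with u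
    refine withDensity_absolutelyContinuous _ _ (Set.Subsingleton.measure_zero ?_ _)
    intro v hv w hw
    simp only [mem_preimage, mem_ofPred_eq] at hv hw
    have hpos : 0 < u * v := Real.sqrt_pos.1 (hv ▸ hx)
    have huv : u * v = u * w := by
      rw [← Real.sqrt_inj hpos.le (Real.sqrt_pos.1 (hw ▸ hx)).le, hv, hw]
    exact mul_left_cancel₀ (left_ne_zero_of_mul hpos.ne') huv
  have key : ContinuousAt (fun y ↦ ∫ p, {p : ℝ × ℝ | y < √(p.1 * p.2)}.indicator
      (fun _ ↦ (1 : ℝ)) p ∂(gammaPair a)) x := by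
    refine continuousAt_of_dominated (bound := fun _ ↦ 1) ?_ ?_ (integrable_const _) ?_
    · refine .of_forall fun y ↦ ?_
      exact (measurable_const.indicator (measurableSet_lt measurable_const hm)).aestronglyMeasurable
    · refine .of_forall fun y ↦ .of_forall fun p ↦ ?_
      rw [indicator]; split_ifs <;> simp
    · have : ∀ᵐ p ∂(gammaPair a), √(p.1 * p.2) ≠ x := by
        rw [ae_iff]; simpa using hnull
      filter_upwards [this] with p hp
      rcases lt_or_gt_of_ne hp with h | h
      · refine ContinuousAt.congr (f := fun _ ↦ (0 : ℝ)) continuousAt_const ?_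
        filter_upwards [lt_mem_nhds h] with y hy
        simp [hy.le]
      · refine ContinuousAt.congr (f := fun _ ↦ (1 : ℝ)) continuousAt_const ?_
        filter_upwards [gt_mem_nhds h] with y hy
        simp [hy]
  refine Complex.continuous_ofReal.continuousAt.comp (f := fun y ↦ survival a y) ?_
  refine key.congr (.of_forall fun y ↦ ?_)
  simp only [survival]
  rw [integral_indicator_const _ (measurableSet_lt measurable_const hm)]
  simp

lemma norm_Gamma_le {z : ℂ} (hz : 0 < z.re) : ‖Complex.Gamma z‖ ≤ Real.Gamma z.re := by
  rw [Complex.Gamma_eq_integral hz, Complex.GammaIntegral, Real.Gamma_eq_integral hz]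
  refine (norm_integral_le_integral_norm _).trans (setIntegral_mono_on ?_ ?_ measurableSet_Ioi ?_)
  · exact (Complex.GammaIntegral_convergent hz).norm
  · exact Real.GammaIntegral_convergent hz
  · intro t ht
    rw [norm_mul, Complex.norm_cpow_eq_rpow_re_of_pos ht, Complex.norm_real,
      Real.norm_of_nonneg (Real.exp_pos _).le]
    simp

/-- Since `Γ(z) = Γ(z + 1)/z`, the functional equation alone gives the decay `|Γ(z)|² ≪ 1/|z|²` on
vertical lines, which is enough for integrability. -/
lemma verticalIntegrable_weightKernel (a : ℕ) {c : ℝ} (hc : 0 < c) :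
    Complex.VerticalIntegrable (weightKernel a) c := by
  set r : ℝ := (c + 1 / 2 + a) / 2 with hr
  have hr0 : 0 < r := by positivity
  set β : ℂ := Complex.Gamma ((1 / 2 + (a : ℂ)) / 2)
  set z : ℝ → ℂ := fun y ↦ ((c : ℂ) + y * Complex.I + 1 / 2 + a) / 2 with hz
  have hzre (y : ℝ) : (z y).re = r := by simp [hz, hr]
  have hzim (y : ℝ) : (z y).im = y / 2 := by simp [hz]
  have hcont : Continuous fun y : ℝ ↦ weightKernel a (c + y * Complex.I) := by
    refine continuous_iff_continuousAt.2 fun y ↦ ?_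
    have hΓ : ContinuousAt (fun y : ℝ ↦ Complex.Gamma (z y)) y := by
      refine ContinuousAt.comp (g := Complex.Gamma) (Complex.continuousAt_Gamma _ fun m hm ↦ ?_)
        (by fun_prop)
      have := congrArg Complex.re hm
      rw [hzre] at this
      simp only [Complex.neg_re, Complex.natCast_re] at this
      have : (0 : ℝ) ≤ m := m.cast_nonneg
      linarith
    have hne : (c : ℂ) + y * Complex.I ≠ 0 := by
      intro h
      have := congrArg Complex.re h
      simp at this
      exact hc.ne' this
    exact ((hΓ.div_const _).pow 2).div (by fun_prop) hne
  set m : ℝ := min (r ^ 2) (1 / 4)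
  have hm : 0 < m := by positivity
  refine Integrable.mono' (g := fun y ↦ (Real.Gamma (r + 1) / ‖β‖) ^ 2 / (m * c) * (1 + y ^ 2)⁻¹)
    (integrable_inv_one_add_sq.const_mul _) hcont.aestronglyMeasurable (.of_forall fun y ↦ ?_)
  have hs : c ≤ ‖(c : ℂ) + y * Complex.I‖ := by
    simpa [abs_of_pos hc] using Complex.abs_re_le_norm ((c : ℂ) + y * Complex.I)
  have hzn : m * (1 + y ^ 2) ≤ ‖z y‖ ^ 2 := by
    rw [← Complex.normSq_eq_norm_sq, Complex.normSq_apply, hzre, hzim]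
    have h1 : m ≤ r ^ 2 := min_le_left _ _
    have h2 : m ≤ 1 / 4 := min_le_right _ _
    nlinarith [mul_le_mul_of_nonneg_right h2 (sq_nonneg y)]
  have hz0 : z y ≠ 0 := by
    intro h
    have := hzre y
    simp [h] at this
    exact hr0.ne this
  have hΓ : ‖Complex.Gamma (z y)‖ ≤ Real.Gamma (r + 1) / ‖z y‖ := by
    rw [le_div_iff₀ (norm_pos_iff.2 hz0), mul_comm, ← norm_mul, ← Complex.Gamma_add_one _ hz0]
    have := norm_Gamma_le (z := z y + 1) (by simp [hzre]; positivity)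
    simpa [hzre] using this
  calc ‖weightKernel a (c + y * Complex.I)‖
      = (‖Complex.Gamma (z y)‖ / ‖β‖) ^ 2 / ‖(c : ℂ) + y * Complex.I‖ := by
        simp [weightKernel, z, β]
    _ ≤ (Real.Gamma (r + 1) / ‖z y‖ / ‖β‖) ^ 2 / c := by gcongr
    _ = (Real.Gamma (r + 1) / ‖β‖) ^ 2 / (‖z y‖ ^ 2 * c) := by ring
    _ ≤ (Real.Gamma (r + 1) / ‖β‖) ^ 2 / (m * (1 + y ^ 2) * c) := by gcongr
    _ = _ := by rw [← div_eq_mul_inv, div_div]; congr 1; ring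

theorem weight_eq_survival {c : ℝ} (hc : 0 < c) (a : ℕ) {x : ℝ} (hx : 0 < x) :
    weight c a x = (survival a x : ℂ) := by
  have hm : Measurable fun p : ℝ × ℝ ↦ √(p.1 * p.2) := by fun_prop
  have hmel {s : ℂ} (hs : 0 < s.re) := mellin_survival (gammaPair a) hm
    (fun _ ↦ Real.sqrt_nonneg _) hs (gammaPair_cpow a hs).1
  have hline (y : ℝ) : weightKernel a (c + y * Complex.I) =
      mellin (fun x ↦ ((survival a x : ℝ) : ℂ)) (c + y * Complex.I) := by
    have hs : 0 < ((c : ℂ) + y * Complex.I).re := by simpa using hc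
    exact ((hmel hs).2.trans (by rw [(gammaPair_cpow a hs).2, weightKernel])).symm
  rw [← mellinInv_mellin_eq c (fun x ↦ ((survival a x : ℝ) : ℂ)) hx
    (hmel (by simpa using hc)).1 ?_ (continuousAt_survival a hx)]
  · simp only [weight, mellinInv, hline]
  · have := verticalIntegrable_weightKernel a hc
    simp only [Complex.VerticalIntegrable, hline] at this ⊢
    exact this

/-- The bound comes from the Mellin inversion integral on the line `Re s = 3`. -/
theorem exists_survival_le (a : ℕ) :
    ∃ B : ℝ, 0 ≤ B ∧ ∀ x : ℝ, 0 < x → survival a x ≤ B / x ^ 3 := by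
  refine ⟨‖(1 / (2 * Real.pi) : ℝ)‖ * ∫ y : ℝ, ‖weightKernel a ((3 : ℝ) + y * Complex.I)‖,
    by positivity, fun x hx ↦ ?_⟩
  have h := weight_eq_survival (c := 3) (by norm_num) a hx
  rw [← Real.norm_of_nonneg (survival_nonneg a x), ← Complex.norm_real, ← h, weight, mellinInv,
    norm_smul, mul_div_assoc]
  gcongr
  rw [← integral_div]
  refine (norm_integral_le_integral_norm _).trans
    (le_of_eq (integral_congr_ae (.of_forall fun y ↦ ?_)))
  have hre : (-(((3 : ℝ) : ℂ) + y * Complex.I)).re = -((3 : ℕ) : ℝ) := by simp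
  simp only [norm_smul, Complex.norm_cpow_eq_rpow_re_of_pos hx]
  rw [hre, Real.rpow_neg hx.le, Real.rpow_natCast, div_eq_inv_mul]

end

/-! ### Sums over integers coprime to `q` -/

section

open Finset

/-- The density `φ(q)/q` of the integers coprime to `q`. -/
def density (q : ℕ) : ℝ := (Nat.totient q : ℝ) / q

/-- The number `ω(q)` of distinct prime factors of `q`. -/
abbrev omega (q : ℕ) : ℕ := ArithmeticFunction.cardDistinctFactors q

lemma omega_eq (q : ℕ) : omega q = q.primeFactors.card := by
  exact ArithmeticFunction.cardDistinctFactors_apply ..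

lemma density_eq_prod {q : ℕ} (hq : q ≠ 0) :
    density q = ∏ p ∈ q.primeFactors, (1 - (p : ℝ)⁻¹) := by
  have h := congrArg (fun x : ℚ ↦ (x : ℝ)) (Nat.totient_eq_mul_prod_factors q)
  push_cast at h
  rw [density, h, mul_div_cancel_left₀ _ (by exact_mod_cast hq)]

lemma density_nonneg (q : ℕ) : 0 ≤ density q := by unfold density; positivity

lemma half_le_one_sub_inv {p : ℕ} (hp : p.Prime) : (1 / 2 : ℝ) ≤ 1 - (p : ℝ)⁻¹ := by
  have : (2 : ℝ) ≤ p := by exact_mod_cast hp.two_le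
  have := inv_anti₀ (by norm_num) this
  linarith

lemma inv_two_pow_le_density {q : ℕ} (hq : q ≠ 0) : ((2 : ℝ) ^ omega q)⁻¹ ≤ density q := by
  rw [density_eq_prod hq, omega_eq, ← inv_pow, ← Finset.prod_const]
  refine Finset.prod_le_prod (fun _ _ ↦ by norm_num) fun p hp ↦ ?_
  have := half_le_one_sub_inv (Nat.prime_of_mem_primeFactors hp)
  norm_num at this ⊢
  exact this

lemma two_pow_omega_le {q : ℕ} (hq : q ≠ 0) : 2 ^ omega q ≤ q := by
  rw [omega_eq, ← Finset.prod_const]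
  calc ∏ p ∈ q.primeFactors, 2 ≤ ∏ p ∈ q.primeFactors, p :=
        Finset.prod_le_prod' fun p hp ↦ (Nat.prime_of_mem_primeFactors hp).two_le
    _ ≤ q := Nat.le_of_dvd (Nat.pos_of_ne_zero hq) (Nat.prod_primeFactors_dvd q)

lemma omega_pos {q : ℕ} (hq : 2 ≤ q) : 1 ≤ omega q := by
  rw [omega_eq, Nat.one_le_iff_ne_zero, Ne, Finset.card_eq_zero, Nat.primeFactors_eq_empty]
  omega

lemma coprime_iff_forall_primeFactors {q : ℕ} (hq : q ≠ 0) (n : ℕ) :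
    n.Coprime q ↔ ∀ p ∈ q.primeFactors, ¬ p ∣ n := by
  rw [← not_iff_not, Nat.Prime.not_coprime_iff_dvd]
  push Not
  exact ⟨fun ⟨p, hp, hn, hq'⟩ ↦ ⟨p, Nat.mem_primeFactors.2 ⟨hp, hq', hq⟩, hn⟩,
    fun ⟨p, hp, hn⟩ ↦ ⟨p, Nat.prime_of_mem_primeFactors hp, hn, Nat.dvd_of_mem_primeFactors hp⟩⟩

lemma prime_not_dvd_mul_iff {P : Finset ℕ} (hP : ∀ p ∈ P, p.Prime) {p : ℕ} (hp : p.Prime)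
    (hpP : p ∉ P) (m : ℕ) : (∀ r ∈ P, ¬ r ∣ p * m) ↔ ∀ r ∈ P, ¬ r ∣ m := by
  refine forall₂_congr fun r hr ↦ not_congr ?_
  rw [(hP r hr).dvd_mul, Nat.prime_dvd_prime_iff_eq (hP r hr) hp]
  exact or_iff_right fun h ↦ hpP (h ▸ hr)

/-- Removing from `ζ(σ)` the integers divisible by a prime of `P` removes the Euler factors at `P`.
-/
lemma tsum_rough_rpow {σ : ℝ} (hσ : 1 < σ) (P : Finset ℕ) (hP : ∀ p ∈ P, p.Prime) :
    ∑' n : ℕ, (if ∀ p ∈ P, ¬ p ∣ n then (n : ℝ) ^ (-σ) else 0) =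
      (∏ p ∈ P, (1 - (p : ℝ) ^ (-σ))) * ∑' n : ℕ, (n : ℝ) ^ (-σ) := by
  have hsum : Summable fun n : ℕ ↦ (n : ℝ) ^ (-σ) := Real.summable_nat_rpow.2 (by linarith)
  have hsum' (f : ℕ → Prop) [DecidablePred f] :
      Summable fun n : ℕ ↦ if f n then (n : ℝ) ^ (-σ) else 0 :=
    hsum.of_nonneg_of_le (fun n ↦ by split_ifs <;> positivity)
      (fun n ↦ by split_ifs; exacts [le_rfl, by positivity])
  induction P using Finset.induction_on with
  | empty => simp
  | insert p P hpP ih =>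
    have hP' : ∀ r ∈ P, r.Prime := fun r hr ↦ hP r (mem_insert_of_mem hr)
    have hp : p.Prime := hP p (mem_insert_self ..)
    set f : ℕ → ℝ := fun n ↦ if ∀ r ∈ P, ¬ r ∣ n then (n : ℝ) ^ (-σ) else 0 with hf
    have hmul (m : ℕ) : f (p * m) = (p : ℝ) ^ (-σ) * f m := by
      simp only [hf, prime_not_dvd_mul_iff hP' hp hpP, mul_ite, mul_zero]
      rw [Nat.cast_mul, Real.mul_rpow (by positivity) (by positivity)]
    have hsplit : ∀ n : ℕ, (if ∀ r ∈ insert p P, ¬ r ∣ n then (n : ℝ) ^ (-σ) else 0) =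
        f n - (if p ∣ n then f n else 0) := by
      intro n
      simp only [forall_mem_insert, hf]
      by_cases h1 : p ∣ n <;> by_cases h2 : ∀ r ∈ P, ¬ r ∣ n <;> simp [h1, h2]
    have hfs : Summable f := hsum' fun n ↦ ∀ r ∈ P, ¬ r ∣ n
    have hfd : Summable fun n ↦ if p ∣ n then f n else 0 := by
      refine hfs.of_nonneg_of_le (fun n ↦ ?_) (fun n ↦ ?_) <;> simp only [hf] <;>
        split_ifs <;> first | positivity | rfl
    have hmult : ∑' n, (if p ∣ n then f n else 0) = ∑' m, f (p * m) := by
      rw [← Function.Injective.tsum_eq (g := fun m : ℕ ↦ p * m)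
        (fun a b h ↦ Nat.eq_of_mul_eq_mul_left hp.pos h)]
      · simp
      · intro n hn
        obtain ⟨m, rfl⟩ : p ∣ n := by
          by_contra h
          simp [h] at hn
        exact ⟨m, rfl⟩
    simp_rw [hsplit]
    rw [hfs.tsum_sub hfd, hmult]
    simp_rw [hmul]
    rw [tsum_mul_left, ih hP', prod_insert hpP]
    ring

/-- Partial sums of `ζ(1 + ε)`, bounded by telescoping. -/
lemma sum_rpow_le {ε : ℝ} (hε : 0 < ε) (N : ℕ) :
    ∑ n ∈ range (N + 2), (n : ℝ) ^ (-(1 + ε)) ≤ 1 + 1 / ε - ((N + 1 : ℕ) : ℝ) ^ (-ε) / ε := by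
  induction N with
  | zero =>
    simp [sum_range_succ, Real.zero_rpow (show -ε + -1 ≠ 0 by linarith)]
  | succ N ih =>
    rw [sum_range_succ]
    set n : ℝ := ((N + 1 : ℕ) : ℝ) with hn
    have hn1 : 1 ≤ n := by simp [hn]
    have hcast : ((N + 2 : ℕ) : ℝ) = n + 1 := by simp [hn]; ring
    simp only [hcast]
    -- `n ^ (-ε) = (n + 1) ^ (-ε) * (1 - 1 / (n + 1)) ^ (-ε) ≥ (n + 1) ^ (-ε) * (1 + ε / (n + 1))`
    have h1 : 1 + ε / (n + 1) ≤ (n / (n + 1)) ^ (-ε) := by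
      rw [Real.rpow_def_of_pos (by positivity)]
      refine le_trans ?_ (Real.add_one_le_exp _)
      have : Real.log (n / (n + 1)) ≤ n / (n + 1) - 1 := Real.log_le_sub_one_of_pos (by positivity)
      have h2 : n / (n + 1) - 1 = - (1 / (n + 1)) := by field_simp; ring
      rw [h2] at this
      have h3 : ε / (n + 1) = ε * (1 / (n + 1)) := by ring
      nlinarith
    have h2 : (n + 1) ^ (-ε) * (1 + ε / (n + 1)) ≤ n ^ (-ε) := by
      calc _ ≤ (n + 1) ^ (-ε) * (n / (n + 1)) ^ (-ε) := by gcongr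
        _ = n ^ (-ε) := by
          rw [← Real.mul_rpow (by positivity) (by positivity)]
          congr 1
          field_simp
    have h3 : (n + 1) ^ (-(1 + ε)) = (n + 1) ^ (-ε) / (n + 1) := by
      rw [show -(1 + ε) = -ε - 1 by ring, Real.rpow_sub_one (by positivity)]
    have h4 : (n + 1) ^ (-(1 + ε)) ≤ (n ^ (-ε) - (n + 1) ^ (-ε)) / ε := by
      rw [le_div_iff₀ hε, h3]
      have : (n + 1) ^ (-ε) * (1 + ε / (n + 1)) =
          (n + 1) ^ (-ε) + (n + 1) ^ (-ε) / (n + 1) * ε := by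
        ring
      linarith
    have h5 : (n ^ (-ε) - (n + 1) ^ (-ε)) / ε = n ^ (-ε) / ε - (n + 1) ^ (-ε) / ε := by ring
    linarith

lemma tsum_rpow_le {ε : ℝ} (hε : 0 < ε) : ∑' n : ℕ, (n : ℝ) ^ (-(1 + ε)) ≤ 1 + 1 / ε := by
  refine Real.tsum_le_of_sum_range_le (fun n ↦ by positivity) fun N ↦ ?_
  refine (sum_le_sum_of_subset_of_nonneg (range_subset_range.2 (Nat.le_add_right N 2))
    fun _ _ _ ↦ by positivity).trans ((sum_rpow_le hε N).trans ?_)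
  have : 0 ≤ ((N + 1 : ℕ) : ℝ) ^ (-ε) / ε := by positivity
  linarith

/-- The Euler factor at `1 + ε` exceeds that at `1` by a factor of at most `exp ε`. -/
lemma one_sub_rpow_le {p : ℕ} (hp : p.Prime) {ε : ℝ} (hε : 0 < ε) :
    1 - (p : ℝ) ^ (-(1 + ε)) ≤ (1 - (p : ℝ)⁻¹) * Real.exp ε := by
  have hp2 : (2 : ℝ) ≤ p := by exact_mod_cast hp.two_le
  have hp0 : (0 : ℝ) < p := by linarith
  have h1 : (p : ℝ) ^ (-(1 + ε)) = (p : ℝ)⁻¹ * (p : ℝ) ^ (-ε) := by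
    rw [show -(1 + ε) = -1 + -ε by ring, Real.rpow_add hp0, Real.rpow_neg_one]
  have h2 : 1 - ε * Real.log p ≤ (p : ℝ) ^ (-ε) := by
    rw [Real.rpow_def_of_pos hp0]
    refine le_trans (le_of_eq ?_) (Real.add_one_le_exp _)
    ring
  have h3 : Real.log p ≤ p / 2 := by
    have h := Real.log_le_sub_one_of_pos (show (0 : ℝ) < p / 2 by positivity)
    rw [Real.log_div hp0.ne' two_ne_zero] at h
    have := Real.log_two_lt_d9
    linarith
  have h4 : (p : ℝ)⁻¹ * Real.log p ≤ 1 / 2 := by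
    rw [inv_mul_le_iff₀ hp0]; linarith
  have h5 := half_le_one_sub_inv hp
  have h6 := Real.add_one_le_exp ε
  calc 1 - (p : ℝ) ^ (-(1 + ε)) ≤ 1 - (p : ℝ)⁻¹ * (1 - ε * Real.log p) := by rw [h1]; gcongr
    _ = 1 - (p : ℝ)⁻¹ + ε * ((p : ℝ)⁻¹ * Real.log p) := by ring
    _ ≤ 1 - (p : ℝ)⁻¹ + ε * (1 - (p : ℝ)⁻¹) := by gcongr; linarith
    _ = (1 - (p : ℝ)⁻¹) * (ε + 1) := by ring
    _ ≤ _ := by gcongr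

/-- At `σ = 1 + 1/(2 log y)`, the product of the Euler factors over `p ∣ q` is within a constant of
`φ(q)/q` as soon as `y ≥ 2^ω(q)`. -/
lemma sum_coprime_rpow_le {q : ℕ} (hq : q ≠ 0) {y : ℝ} (hy : 2 ≤ y) (hyq : 2 ^ omega q ≤ y)
    (A : Finset ℕ) (hA : ∀ r ∈ A, r.Coprime q) :
    ∑ r ∈ A, (r : ℝ) ^ (-(1 + 1 / (2 * Real.log y))) ≤ 10 * density q * Real.log y := by
  classical
  have hl2 := Real.log_two_gt_d9
  have hly : Real.log 2 ≤ Real.log y := Real.log_le_log (by norm_num) hy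
  have hly0 : 0 < Real.log y := by linarith
  set ε := 1 / (2 * Real.log y) with hε
  have hε0 : 0 < ε := by positivity
  have hsum : Summable fun n : ℕ ↦ if ∀ p ∈ q.primeFactors, ¬ p ∣ n then
      (n : ℝ) ^ (-(1 + ε)) else 0 :=
    (Real.summable_nat_rpow.2 (show -(1 + ε) < -1 by linarith)).of_nonneg_of_le
      (fun n ↦ by split_ifs <;> positivity) (fun n ↦ by split_ifs; exacts [le_rfl, by positivity])
  have hexp : Real.exp (ε * omega q) ≤ 2.7182818286 := by
    refine le_trans (Real.exp_le_exp.2 ?_) Real.exp_one_lt_d9.le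
    have h := Real.log_le_log (by positivity) hyq
    rw [Real.log_pow] at h
    rw [hε, div_mul_eq_mul_div, one_mul, div_le_one (by positivity)]
    have : (0 : ℝ) ≤ omega q := Nat.cast_nonneg _
    nlinarith
  have hden := density_nonneg q
  calc ∑ r ∈ A, (r : ℝ) ^ (-(1 + ε))
      = ∑ r ∈ A, (if ∀ p ∈ q.primeFactors, ¬ p ∣ r then (r : ℝ) ^ (-(1 + ε)) else 0) :=
        sum_congr rfl fun r hr ↦ (if_pos ((coprime_iff_forall_primeFactors hq r).1 (hA r hr))).symm
    _ ≤ _ := hsum.sum_le_tsum A (fun n _ ↦ by split_ifs <;> positivity)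
    _ = (∏ p ∈ q.primeFactors, (1 - (p : ℝ) ^ (-(1 + ε)))) * ∑' n : ℕ, (n : ℝ) ^ (-(1 + ε)) :=
        tsum_rough_rpow (by linarith) _ fun p hp ↦ Nat.prime_of_mem_primeFactors hp
    _ ≤ (∏ p ∈ q.primeFactors, ((1 - (p : ℝ)⁻¹) * Real.exp ε)) * (1 + 1 / ε) := by
        refine mul_le_mul (prod_le_prod (fun p hp ↦ ?_) fun p hp ↦
          one_sub_rpow_le (Nat.prime_of_mem_primeFactors hp) hε0) (tsum_rpow_le hε0)
          (tsum_nonneg fun n ↦ by positivity) (prod_nonneg fun p hp ↦ ?_)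
        · have : (1 : ℝ) ≤ p := by exact_mod_cast (Nat.prime_of_mem_primeFactors hp).one_le
          have := Real.rpow_le_one_of_one_le_of_nonpos this (show -(1 + ε) ≤ 0 by linarith)
          linarith
        · have := half_le_one_sub_inv (Nat.prime_of_mem_primeFactors hp)
          have : 0 ≤ 1 - (p : ℝ)⁻¹ := by linarith
          positivity
    _ = density q * Real.exp (ε * omega q) * (1 + 2 * Real.log y) := by
        rw [prod_mul_distrib, ← density_eq_prod hq, prod_const, ← omega_eq, ← Real.exp_nat_mul,
          mul_comm ε, hε]
        congr 1
        field_simp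
    _ ≤ density q * 2.7182818286 * (3.5 * Real.log y) := by
        gcongr
        linarith
    _ ≤ _ := by nlinarith [mul_nonneg hden hly0.le]

lemma min_one_div_le_rpow {y : ℝ} (hy : 2 ≤ y) {r : ℝ} (hr : 1 ≤ r) :
    min 1 (y / r) ≤ 2 * r ^ (-(1 / (2 * Real.log y))) := by
  have hl2 := Real.log_two_gt_d9
  have hly : Real.log 2 ≤ Real.log y := Real.log_le_log (by norm_num) hy
  have hly0 : 0 < Real.log y := by linarith
  have hr0 : 0 < r := by linarith
  have hhalf : 1 ≤ 2 * Real.exp (-(1 / 2)) := by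
    have := Real.add_one_le_exp (-(1 / 2) : ℝ)
    linarith
  rw [Real.rpow_def_of_pos hr0]
  rcases le_total r y with h | h
  · refine (min_le_left _ _).trans (hhalf.trans ?_)
    gcongr
    have : Real.log r ≤ Real.log y := Real.log_le_log hr0 h
    have h2 : Real.log r * (1 / (2 * Real.log y)) ≤ 1 / 2 := by
      rw [mul_one_div, div_le_div_iff₀ (by positivity) (by norm_num)]
      linarith
    linarith
  · refine (min_le_right _ _).trans ?_
    have : y / r = 1 * Real.exp (Real.log y - Real.log r) := by
      rw [Real.exp_sub, Real.exp_log (by linarith), Real.exp_log hr0, one_mul]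
    rw [this]
    have h1 : Real.log y ≤ Real.log r := Real.log_le_log (by linarith) h
    calc 1 * Real.exp (Real.log y - Real.log r)
        ≤ 2 * Real.exp (-(1 / 2)) * Real.exp (Real.log y - Real.log r) := by gcongr
      _ = 2 * Real.exp (-(1 / 2) + (Real.log y - Real.log r)) := by rw [mul_assoc, Real.exp_add]
      _ ≤ _ := by
        gcongr
        have h2 : Real.log r * -(1 / (2 * Real.log y)) =
            -(1 / 2) + (Real.log y - Real.log r) * (1 / (2 * Real.log y)) := by
          field_simp; ring
        rw [h2]
        have h3 : 1 / (2 * Real.log y) ≤ 1 := by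
          rw [div_le_one (by positivity)]; linarith
        nlinarith

/-- A smooth form of `∑_{r ≤ y, (r, q) = 1} 1/r ≪ φ(q)/q · log y`, uniform in `y ≥ 2^ω(q)`. -/
lemma sum_coprime_min_div_le {q : ℕ} (hq : q ≠ 0) {y : ℝ} (hy : 2 ≤ y) (hyq : 2 ^ omega q ≤ y)
    (A : Finset ℕ) (hA : ∀ r ∈ A, r.Coprime q) :
    ∑ r ∈ A, min 1 (y / r) / r ≤ 20 * density q * Real.log y := by
  have h := sum_coprime_rpow_le hq hy hyq A hA
  calc ∑ r ∈ A, min 1 (y / r) / r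
      ≤ ∑ r ∈ A, 2 * (r : ℝ) ^ (-(1 + 1 / (2 * Real.log y))) := by
        refine sum_le_sum fun r hr ↦ ?_
        rcases Nat.eq_zero_or_pos r with rfl | hr0
        · simp; positivity
        · have hr1 : (1 : ℝ) ≤ r := by exact_mod_cast hr0
          rw [show -(1 + 1 / (2 * Real.log y)) = -(1 / (2 * Real.log y)) - 1 by ring,
            Real.rpow_sub_one (by positivity), ← mul_div_assoc]
          gcongr
          exact min_one_div_le_rpow hy hr1
    _ ≤ _ := by rw [← mul_sum]; linarith

lemma sum_min_div_le {y : ℝ} (hy : 2 ≤ y) (A : Finset ℕ) :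
    ∑ r ∈ A, min 1 (y / r) / r ≤ 20 * Real.log y := by
  have h := sum_coprime_min_div_le one_ne_zero hy (by simp [omega]; linarith) A (by simp)
  simpa [density] using h

end

/-! ### The sieve and dyadic blocks -/

section

open Finset

/-- Legendre's sieve: the number of `g ≤ x` without a prime factor in `P` is `x ∏ (1 - 1/p)` up to
`2 ^ #P`. -/
lemma abs_card_rough_sub_le (P : Finset ℕ) (hP : ∀ p ∈ P, p.Prime) {x : ℝ} (hx : 0 ≤ x) :
    |(((Icc 1 ⌊x⌋₊).filter fun g ↦ ∀ p ∈ P, ¬ p ∣ g).card : ℝ) - x * ∏ p ∈ P, (1 - (p : ℝ)⁻¹)| ≤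
      2 ^ P.card := by
  induction P using Finset.induction_on generalizing x with
  | empty =>
    simp only [notMem_empty, false_implies, implies_true, filter_true, Nat.card_Icc, prod_empty,
      card_empty]
    have h1 := Nat.floor_le hx
    have h2 := Nat.lt_floor_add_one x
    rw [abs_le]
    constructor <;> simp <;> linarith
  | insert p P hpP ih =>
    have hP' : ∀ r ∈ P, r.Prime := fun r hr ↦ hP r (mem_insert_of_mem hr)
    have hp : p.Prime := hP p (mem_insert_self ..)
    have h1 := ih hP' hx
    have h2 := ih hP' (x := x / p) (by positivity)
    rw [Nat.floor_div_natCast] at h2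
    have hcard : ((Icc 1 ⌊x⌋₊).filter fun g ↦ ∀ r ∈ insert p P, ¬ r ∣ g).card +
        ((Icc 1 (⌊x⌋₊ / p)).filter fun g ↦ ∀ r ∈ P, ¬ r ∣ g).card =
        ((Icc 1 ⌊x⌋₊).filter fun g ↦ ∀ r ∈ P, ¬ r ∣ g).card := by
      rw [← card_filter_add_card_filter_not (s := (Icc 1 ⌊x⌋₊).filter fun g ↦ ∀ r ∈ P, ¬ r ∣ g)
        (fun g ↦ ¬ p ∣ g)]
      congr 1
      · congr 1
        ext g
        simp only [mem_filter, forall_mem_insert]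
        tauto
      · refine card_bij (fun g _ ↦ p * g) ?_ ?_ ?_
        · intro g hg
          simp only [mem_filter, mem_Icc, not_not] at hg ⊢
          refine ⟨⟨⟨Nat.mul_pos hp.pos hg.1.1, ?_⟩,
            (prime_not_dvd_mul_iff hP' hp hpP g).2 hg.2⟩, dvd_mul_right _ _⟩
          rw [mul_comm]
          exact (Nat.le_div_iff_mul_le hp.pos).1 hg.1.2
        · intro g _ g' _ h
          exact Nat.eq_of_mul_eq_mul_left hp.pos h
        · intro g hg
          simp only [mem_filter, mem_Icc, not_not] at hg
          obtain ⟨⟨⟨hg1, hg2⟩, hg3⟩, g, rfl⟩ := hg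
          refine ⟨g, ?_, rfl⟩
          simp only [mem_filter, mem_Icc]
          refine ⟨⟨Nat.pos_of_mul_pos_left hg1, ?_⟩, (prime_not_dvd_mul_iff hP' hp hpP g).1 hg3⟩
          rw [Nat.le_div_iff_mul_le hp.pos, mul_comm]
          exact hg2
    have hcard' := congrArg (fun n : ℕ ↦ (n : ℝ)) hcard
    push_cast at hcard'
    rw [prod_insert hpP, card_insert_of_notMem hpP, pow_succ]
    set R := ∏ p ∈ P, (1 - (p : ℝ)⁻¹)
    have hR : x * ((1 - (p : ℝ)⁻¹) * R) = x * R - x / p * R := by ring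
    rw [hR]
    rw [abs_le] at h1 h2 ⊢
    constructor <;> linarith [h1.1, h1.2, h2.1, h2.2]

/-- From `4^ω(q)` on, the main term `Y φ(q)/q ≥ Y/2^ω(q)` of the sieve dominates its error `2^ω(q)`.
-/
lemma sum_coprime_Ioc_le {q : ℕ} (hq : q ≠ 0) {Y : ℕ} (hY : 4 ^ omega q ≤ Y) :
    ∑ g ∈ (Ioc Y (2 * Y)).filter (·.Coprime q), (1 : ℝ) / g ≤ 3 * density q := by
  have hY0 : 0 < Y := lt_of_lt_of_le (by positivity) hY
  have hY0' : (0 : ℝ) < Y := by exact_mod_cast hY0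
  have hN (x : ℕ) : |(((Icc 1 x).filter (·.Coprime q)).card : ℝ) - x * density q| ≤
      2 ^ omega q := by
    have h := abs_card_rough_sub_le q.primeFactors
      (fun p hp ↦ Nat.prime_of_mem_primeFactors hp) (Nat.cast_nonneg (α := ℝ) x)
    rw [Nat.floor_natCast, ← density_eq_prod hq, ← omega_eq] at h
    simpa only [coprime_iff_forall_primeFactors hq] using h
  have hsplit : ((Icc 1 Y).filter (·.Coprime q)).card + ((Ioc Y (2 * Y)).filter (·.Coprime q)).card
      = ((Icc 1 (2 * Y)).filter (·.Coprime q)).card := by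
    rw [← card_union_of_disjoint]
    · congr 1
      ext g
      simp only [mem_union, mem_filter, mem_Icc, mem_Ioc, ← or_and_right]
      refine and_congr_left fun _ ↦ ?_
      omega
    · rw [disjoint_left]
      intro g h1 h2
      simp only [mem_filter, mem_Icc, mem_Ioc] at h1 h2
      omega
  have h1 := abs_le.1 (hN Y)
  have h2 := abs_le.1 (hN (2 * Y))
  have hsplit' := congrArg (fun n : ℕ ↦ (n : ℝ)) hsplit
  push_cast at hsplit' h2
  have hcard : (((Ioc Y (2 * Y)).filter (·.Coprime q)).card : ℝ) ≤
      Y * density q + 2 * 2 ^ omega q := by linarith [h1.1, h2.2]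
  have hpow : (2 : ℝ) ^ omega q ≤ Y * density q := by
    have h := inv_two_pow_le_density hq
    have hY' : (4 : ℝ) ^ omega q ≤ Y := by exact_mod_cast hY
    calc (2 : ℝ) ^ omega q = 4 ^ omega q * (2 ^ omega q)⁻¹ := by
          rw [show (4 : ℝ) = 2 * 2 by norm_num, mul_pow]; field_simp
      _ ≤ Y * density q := by gcongr
  calc ∑ g ∈ (Ioc Y (2 * Y)).filter (·.Coprime q), (1 : ℝ) / g
      ≤ ∑ g ∈ (Ioc Y (2 * Y)).filter (·.Coprime q), (1 : ℝ) / Y := by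
        refine sum_le_sum fun g hg ↦ ?_
        have : (Y : ℝ) ≤ g := by exact_mod_cast (mem_Ioc.1 (mem_filter.1 hg).1).1.le
        gcongr
    _ = ((Ioc Y (2 * Y)).filter (·.Coprime q)).card / Y := by
        rw [sum_const, nsmul_eq_mul, mul_one_div]
    _ ≤ 3 * density q := by
        rw [div_le_iff₀ hY0']
        linarith

/-- The first `k + 1` exponents from the least element of `T` on contribute at most `1` each; beyond
them `y / 4 ^ j` decays geometrically. -/
lemma sum_min_div_four_pow_le {y : ℝ} (k : ℕ) (T : Finset ℕ)
    (hT : ∀ j ∈ T, y < 4 ^ (j + 1) * 2 ^ k) :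
    ∑ j ∈ T, min 1 (y / 4 ^ j) ≤ k + 3 := by
  rcases T.eq_empty_or_nonempty with rfl | hne
  · simp; positivity
  set j₀ := T.min' hne
  have hj₀ : y ≤ 4 ^ (j₀ + 1 + k) := by
    refine (hT j₀ (T.min'_mem hne)).le.trans ?_
    rw [pow_add _ (j₀ + 1)]
    gcongr
    norm_num
  rw [← sum_filter_add_sum_filter_not T (fun j ↦ j < j₀ + 1 + k)]
  have h1 : ∑ j ∈ T with j < j₀ + 1 + k, min 1 (y / 4 ^ j) ≤ k + 1 := by
    calc _ ≤ ∑ j ∈ T with j < j₀ + 1 + k, (1 : ℝ) := sum_le_sum fun _ _ ↦ min_le_left _ _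
      _ ≤ ∑ j ∈ Ico j₀ (j₀ + 1 + k), (1 : ℝ) := by
        refine sum_le_sum_of_subset_of_nonneg (fun j hj ↦ ?_) fun _ _ _ ↦ zero_le_one
        rw [mem_filter] at hj
        exact mem_Ico.2 ⟨T.min'_le j hj.1, hj.2⟩
      _ = k + 1 := by
        rw [sum_const, Nat.card_Ico, add_assoc, Nat.add_sub_cancel_left]
        simp [add_comm]
  have h2 : ∑ j ∈ T with ¬ j < j₀ + 1 + k, min 1 (y / 4 ^ j) ≤ 2 := by
    calc _ ≤ ∑ j ∈ T with ¬ j < j₀ + 1 + k, (1 / 4 : ℝ) ^ (j - (j₀ + 1 + k)) := by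
          refine sum_le_sum fun j hj ↦ (min_le_right _ _).trans ?_
          rw [mem_filter, not_lt] at hj
          rw [div_le_iff₀ (by positivity)]
          refine hj₀.trans (le_of_eq ?_)
          obtain ⟨i, rfl⟩ := Nat.exists_eq_add_of_le hj.2
          rw [pow_add _ (j₀ + 1 + k) i, Nat.add_sub_cancel_left, mul_left_comm, ← mul_pow]
          norm_num
      _ = ∑ i ∈ ({j ∈ T | ¬ j < j₀ + 1 + k}).image (· - (j₀ + 1 + k)), (1 / 4 : ℝ) ^ i := by
          rw [sum_image]
          intro j hj j' hj' h
          simp only [coe_filter, Set.mem_ofPred_eq, not_lt] at hj hj' h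
          omega
      _ ≤ ∑' i : ℕ, (1 / 4 : ℝ) ^ i :=
          (summable_geometric_of_lt_one (by norm_num) (by norm_num)).sum_le_tsum _
            fun _ _ ↦ by positivity
      _ ≤ 2 := by
          rw [tsum_geometric_of_lt_one (by norm_num) (by norm_num)]
          norm_num
  linarith

/-- The sum of `1/g` over `g` coprime to `q` with `cutoff q < g² n ≲ q` is `O(ω(q) φ(q)/q)`,
uniformly in `n`. -/
lemma sum_coprime_sq_mul_le {q : ℕ} (hq : 2 ≤ q) {n : ℕ} (hn : 0 < n) (A : Finset ℕ)
    (hA : ∀ g ∈ A, 0 < g ∧ g.Coprime q ∧ cutoff q < (g : ℝ) ^ 2 * n) :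
    ∑ g ∈ A, min 1 (q / ((g : ℝ) ^ 2 * n)) / g ≤ 40 * density q * omega q := by
  have hq0 : q ≠ 0 := by omega
  have hden := density_nonneg q
  have hω : (1 : ℝ) ≤ omega q := by exact_mod_cast omega_pos hq
  have hn0 : (0 : ℝ) < n := by exact_mod_cast hn
  rw [← sum_filter_add_sum_filter_not A (fun g ↦ g ≤ 4 ^ omega q)]
  have h1 : ∑ g ∈ A with g ≤ 4 ^ omega q, min 1 (q / ((g : ℝ) ^ 2 * n)) / g ≤
      28 * density q * omega q := by
    have hlog4 : Real.log 4 ≤ 1.4 := by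
      rw [show (4 : ℝ) = 2 ^ 2 by norm_num, Real.log_pow]
      have := Real.log_two_lt_d9
      norm_num; linarith
    calc _ ≤ ∑ g ∈ A with g ≤ 4 ^ omega q, min 1 ((4 : ℝ) ^ omega q / g) / g := by
          refine sum_le_sum fun g hg ↦ ?_
          rw [mem_filter] at hg
          have hg0 : (0 : ℝ) < g := by exact_mod_cast (hA g hg.1).1
          have : (g : ℝ) ≤ 4 ^ omega q := by exact_mod_cast hg.2
          rw [min_eq_left (b := (4 : ℝ) ^ omega q / g) ((one_le_div hg0).2 this)]
          gcongr
          exact min_le_left _ _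
      _ ≤ 20 * density q * Real.log (4 ^ omega q) := by
          refine sum_coprime_min_div_le hq0 ?_ ?_ _ fun g hg ↦ (hA g (mem_filter.1 hg).1).2.1
          · calc (2 : ℝ) ≤ 4 ^ 1 := by norm_num
              _ ≤ 4 ^ omega q := pow_le_pow_right₀ (by norm_num) (omega_pos hq)
          · gcongr; norm_num
      _ = 20 * density q * omega q * Real.log 4 := by rw [Real.log_pow]; ring
      _ ≤ 20 * density q * omega q * 1.4 := by gcongr
      _ = _ := by ring
  have h2 : ∑ g ∈ A with ¬ g ≤ 4 ^ omega q, min 1 (q / ((g : ℝ) ^ 2 * n)) / g ≤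
      12 * density q * omega q := by
    set B := {g ∈ A | ¬ g ≤ 4 ^ omega q} with hB
    -- `g` lies in the dyadic block `(2 ^ j, 2 ^ (j + 1)]` for `j = J g`
    set J : ℕ → ℕ := fun g ↦ Nat.clog 2 g - 1 with hJ
    have hBg (g : ℕ) (hg : g ∈ B) : 2 ^ J g < g ∧ g ≤ 2 * 2 ^ J g ∧ 4 ^ omega q ≤ 2 ^ J g := by
      rw [hB, mem_filter, not_le] at hg
      have hg1 : 1 < g := lt_of_le_of_lt (Nat.one_le_pow _ _ (by norm_num)) hg.2
      have hc : 1 ≤ Nat.clog 2 g := Nat.clog_pos one_lt_two hg1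
      have hle : g ≤ 2 * 2 ^ J g := by
        rw [← pow_succ', hJ, Nat.sub_add_cancel hc]
        exact Nat.le_pow_clog one_lt_two g
      refine ⟨Nat.pow_pred_clog_lt_self one_lt_two hg1, hle, ?_⟩
      have : 2 ^ (2 * omega q) < 2 ^ (J g + 1) := by
        rw [pow_mul, pow_succ' 2 (J g)]
        exact lt_of_lt_of_le hg.2 hle
      have := (Nat.pow_lt_pow_iff_right one_lt_two).1 this
      rw [show 4 = 2 ^ 2 by norm_num, ← pow_mul]
      exact Nat.pow_le_pow_right two_pos (by omega)
    rw [← sum_fiberwise_of_maps_to (fun g hg ↦ mem_image_of_mem J hg)]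
    calc _ ≤ ∑ j ∈ B.image J, min 1 ((q / n : ℝ) / 4 ^ j) * (3 * density q) := by
          refine sum_le_sum fun j hj ↦ ?_
          obtain ⟨g₀, hg₀, rfl⟩ := mem_image.1 hj
          calc _ ≤ ∑ g ∈ B with J g = J g₀, min 1 ((q / n : ℝ) / 4 ^ J g₀) * (1 / g) := by
                refine sum_le_sum fun g hg ↦ ?_
                rw [mem_filter] at hg
                rw [div_eq_mul_one_div]
                have : (4 : ℝ) ^ J g₀ ≤ (g : ℝ) ^ 2 := by
                  rw [← hg.2, show (4 : ℝ) = 2 ^ 2 by norm_num, ← pow_mul, mul_comm, pow_mul]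
                  gcongr
                  exact_mod_cast (hBg g hg.1).1.le
                rw [div_div, mul_comm (n : ℝ)]
                gcongr
            _ ≤ min 1 ((q / n : ℝ) / 4 ^ J g₀) * (3 * density q) := by
                rw [← mul_sum]
                gcongr
                refine le_trans ?_ (sum_coprime_Ioc_le hq0 (hBg g₀ hg₀).2.2)
                refine sum_le_sum_of_subset_of_nonneg (fun g hg ↦ ?_) fun _ _ _ ↦ by positivity
                rw [mem_filter] at hg
                have := hBg g hg.1
                rw [hg.2] at this
                exact mem_filter.2 ⟨mem_Ioc.2 ⟨this.1, this.2.1⟩,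
                  (hA g (mem_filter.1 hg.1).1).2.1⟩
      _ ≤ (omega q + 3) * (3 * density q) := by
          rw [← sum_mul]
          gcongr
          refine sum_min_div_four_pow_le _ _ fun j hj ↦ ?_
          obtain ⟨g, hg, rfl⟩ := mem_image.1 hj
          have hcut := (hA g (mem_filter.1 hg).1).2.2
          rw [cutoff, div_lt_iff₀ (by positivity)] at hcut
          rw [div_lt_iff₀ hn0]
          have : (g : ℝ) ^ 2 ≤ 4 ^ (J g + 1) := by
            rw [show (4 : ℝ) = 2 ^ 2 by norm_num, ← pow_mul, mul_comm 2, pow_mul, pow_succ' 2]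
            gcongr
            exact_mod_cast (hBg g hg).2.1
          calc (q : ℝ) < (g : ℝ) ^ 2 * n * 2 ^ omega q := hcut
            _ ≤ 4 ^ (J g + 1) * n * 2 ^ omega q := by gcongr
            _ = _ := by ring
      _ ≤ (4 * omega q) * (3 * density q) := by gcongr; linarith
      _ = _ := by ring
  linarith

end

/-! ### The majorant -/

section

open Finset

/-- The factor `min(1, q/x)` measuring the decay of the weights beyond `x = q`. -/
def decay (q : ℕ) (x : ℝ) : ℝ := min 1 (q / x)

lemma decay_le_one (q : ℕ) (x : ℝ) : decay q x ≤ 1 := min_le_left _ _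

lemma decay_nonneg (q : ℕ) {x : ℝ} (hx : 0 ≤ x) : 0 ≤ decay q x :=
  le_min zero_le_one (by positivity)

lemma decay_anti (q : ℕ) {x y : ℝ} (hx : 0 < x) (hxy : x ≤ y) : decay q y ≤ decay q x :=
  min_le_min le_rfl (by gcongr)

lemma min_div_mul_decay_le (q : ℕ) {b d : ℝ} (hb : 0 < b) (hd : 0 < d) :
    min 1 (d / b) * decay q d ≤ decay q b := by
  refine le_min (mul_le_one₀ (min_le_left _ _) (decay_nonneg q hd.le) (min_le_left _ _)) ?_
  calc min 1 (d / b) * decay q d ≤ d / b * (q / d) := by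
        gcongr
        · exact decay_nonneg q hd.le
        · exact min_le_right _ _
        · exact min_le_right _ _
    _ = q / b := by field_simp

/-- The function `min(1, q/(ab))³ / √(ab)`, which bounds the coefficient of `χ(a) χ̄(b)` up to a
constant. -/
def majorant (q : ℕ) (p : ℕ × ℕ) : ℝ :=
  decay q ((p.1 : ℝ) * p.2) ^ 3 / √((p.1 : ℝ) * p.2)

lemma majorant_nonneg (q : ℕ) (p : ℕ × ℕ) : 0 ≤ majorant q p := by
  have := decay_nonneg q (x := (p.1 : ℝ) * p.2) (by positivity)
  unfold majorant
  positivity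

end

/-! ### Diagonal terms -/

section

open Finset

/-- The primitive vector proportional to `p`. -/
def primPart (p : ℕ × ℕ) : ℕ × ℕ := (p.1 / p.1.gcd p.2, p.2 / p.1.gcd p.2)

lemma primPart_eq_of_mul_eq {p p' : ℕ × ℕ} (h1 : 0 < p.1) (h2 : 0 < p.2) (h1' : 0 < p'.1)
    (h : p.1 * p'.2 = p.2 * p'.1) : primPart p = primPart p' := by
  obtain ⟨a, b⟩ := p
  obtain ⟨c, d⟩ := p'
  dsimp only at h1 h2 h1' h
  obtain ⟨g, r, s, hg, hrs, rfl, rfl⟩ := Nat.exists_coprime' (Nat.gcd_pos_of_pos_left b h1)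
  obtain ⟨g', r', s', hg', hrs', rfl, rfl⟩ := Nat.exists_coprime' (Nat.gcd_pos_of_pos_left d h1')
  have hmul : r * s' = s * r' := by
    have : g * g' * (r * s') = g * g' * (s * r') := by linarith
    exact Nat.eq_of_mul_eq_mul_left (Nat.mul_pos hg hg') this
  have hr : r = r' := by
    refine Nat.dvd_antisymm (hrs.dvd_of_dvd_mul_left ⟨s', hmul.symm⟩) ?_
    exact hrs'.dvd_of_dvd_mul_right ⟨s, by rw [hmul, mul_comm]⟩
  have hs : s = s' := by
    subst hr
    exact (Nat.eq_of_mul_eq_mul_left (Nat.pos_of_mul_pos_right h1) (by rw [hmul, mul_comm])).symm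
  subst hr hs
  simp [primPart, Nat.gcd_mul_right, hrs.gcd_eq_one, Nat.mul_div_cancel _ hg,
    Nat.mul_div_cancel _ hg']

/-- The sum of the majorant over the multiples `g v` of a primitive vector `v` with product beyond
the cutoff. -/
lemma sum_primPart_le {q : ℕ} (hq : 2 ≤ q) (S : Finset (ℕ × ℕ))
    (hS : ∀ p ∈ S, 0 < p.1 ∧ 0 < p.2 ∧ p.1.Coprime q ∧ p.2.Coprime q ∧
      cutoff q < (p.1 : ℝ) * p.2) {v : ℕ × ℕ} (hv : 0 < v.1 ∧ 0 < v.2) :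
    ∑ p ∈ S with primPart p = v, majorant q p ≤
      decay q ((v.1 : ℝ) * v.2) / √((v.1 : ℝ) * v.2) * (40 * density q * omega q) := by
  obtain ⟨r, s⟩ := v
  dsimp only at hv ⊢
  have hrs : 0 < r * s := Nat.mul_pos hv.1 hv.2
  have hrs' : (0 : ℝ) < (r : ℝ) * s := by exact_mod_cast hrs
  set B := {p ∈ S | primPart p = (r, s)} with hB
  have hform (p : ℕ × ℕ) (hp : p ∈ B) :
      p.1 = p.1.gcd p.2 * r ∧ p.2 = p.1.gcd p.2 * s ∧ 0 < p.1.gcd p.2 := by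
    rw [hB, mem_filter, primPart, Prod.mk.injEq] at hp
    obtain ⟨hp, h1, h2⟩ := hp
    rw [← h1, ← h2]
    exact ⟨(Nat.mul_div_cancel' (Nat.gcd_dvd_left ..)).symm,
      (Nat.mul_div_cancel' (Nat.gcd_dvd_right ..)).symm, Nat.gcd_pos_of_pos_left _ (hS p hp).1⟩
  have hsum := sum_coprime_sq_mul_le hq hrs (B.image fun p ↦ p.1.gcd p.2) ?_
  · rw [sum_image] at hsum
    · refine le_trans ?_ (mul_le_mul_of_nonneg_left hsum
        (div_nonneg (decay_nonneg q hrs'.le) (Real.sqrt_nonneg _)))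
      rw [mul_sum]
      refine sum_le_sum fun p hp ↦ ?_
      obtain ⟨h1, h2, hg⟩ := hform p hp
      set g := p.1.gcd p.2
      have hg' : (1 : ℝ) ≤ g := by exact_mod_cast hg
      have hx : (p.1 : ℝ) * p.2 = (g : ℝ) ^ 2 * ((r : ℝ) * s) := by
        rw [h1, h2]; push_cast; ring
      rw [majorant, hx, Nat.cast_mul, Real.sqrt_mul (by positivity), Real.sqrt_sq (by positivity)]
      set D := decay q ((g : ℝ) ^ 2 * ((r : ℝ) * s)) with hD
      have hD0 : 0 ≤ D := decay_nonneg q (by positivity)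
      have hD1 : D ≤ decay q ((r : ℝ) * s) :=
        decay_anti q hrs' (le_mul_of_one_le_left hrs'.le (one_le_pow₀ hg'))
      have hD3 : D ^ 3 ≤ decay q ((r : ℝ) * s) * D := by
        have := decay_le_one q ((g : ℝ) ^ 2 * ((r : ℝ) * s))
        calc D ^ 3 = D * D * D := by ring
          _ ≤ decay q ((r : ℝ) * s) * D * 1 := by gcongr; exact mul_nonneg (hD0.trans hD1) hD0
          _ = _ := mul_one _
      calc D ^ 3 / (g * √((r : ℝ) * s)) ≤ decay q ((r : ℝ) * s) * D / (g * √((r : ℝ) * s)) := by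
            gcongr
        _ = decay q ((r : ℝ) * s) / √((r : ℝ) * s) * (D / g) := by
            rw [div_mul_div_comm, mul_comm (g : ℝ)]
    · intro p hp p' hp' hgg
      obtain ⟨h1, h2, -⟩ := hform p hp
      obtain ⟨h1', h2', -⟩ := hform p' hp'
      dsimp only at hgg
      exact Prod.ext (by rw [h1, h1', hgg]) (by rw [h2, h2', hgg])
  · intro g hg
    obtain ⟨p, hp, rfl⟩ := mem_image.1 hg
    obtain ⟨h1, h2, hg0⟩ := hform p hp
    obtain ⟨-, -, hc, -, hcut⟩ := hS p (mem_filter.1 hp).1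
    refine ⟨hg0, hc.coprime_dvd_left (Nat.gcd_dvd_left ..), hcut.trans_le (le_of_eq ?_)⟩
    have h1' : (p.1 : ℝ) = p.1.gcd p.2 * r := by exact_mod_cast h1
    have h2' : (p.2 : ℝ) = p.1.gcd p.2 * s := by exact_mod_cast h2
    rw [h1', h2']
    push_cast
    ring

theorem diagonal_le {q : ℕ} (hq : 2 ≤ q) (S : Finset (ℕ × ℕ))
    (hS : ∀ p ∈ S, 0 < p.1 ∧ 0 < p.2 ∧ p.1.Coprime q ∧ p.2.Coprime q ∧
      cutoff q < (p.1 : ℝ) * p.2) :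
    ∑ p ∈ S, ∑ p' ∈ S with p.1 * p'.2 = p.2 * p'.1, majorant q p * majorant q p' ≤
      (40 * density q * omega q) ^ 2 * (20 * density q * Real.log q) ^ 2 := by
  have hq0 : q ≠ 0 := by omega
  have hden := density_nonneg q
  set V := S.image primPart
  have hV (v : ℕ × ℕ) (hv : v ∈ V) :
      0 < v.1 ∧ 0 < v.2 ∧ v.1.Coprime q ∧ v.2.Coprime q := by
    obtain ⟨p, hp, rfl⟩ := mem_image.1 hv
    obtain ⟨h1, h2, hc1, hc2, -⟩ := hS p hp
    exact ⟨Nat.div_pos (Nat.gcd_le_left _ h1) (Nat.gcd_pos_of_pos_left _ h1),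
      Nat.div_pos (Nat.gcd_le_right _ h2) (Nat.gcd_pos_of_pos_left _ h1),
      hc1.coprime_dvd_left (Nat.div_dvd_of_dvd (Nat.gcd_dvd_left ..)),
      hc2.coprime_dvd_left (Nat.div_dvd_of_dvd (Nat.gcd_dvd_right ..))⟩
  have hq2 : (2 : ℝ) ≤ q := by exact_mod_cast hq
  have hωq : (2 : ℝ) ^ omega q ≤ q := by exact_mod_cast two_pow_omega_le hq0
  calc ∑ p ∈ S, ∑ p' ∈ S with p.1 * p'.2 = p.2 * p'.1, majorant q p * majorant q p'
      ≤ ∑ p ∈ S, ∑ p' ∈ S with primPart p' = primPart p, majorant q p * majorant q p' := by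
        refine sum_le_sum fun p hp ↦ sum_le_sum_of_subset_of_nonneg (fun p' hp' ↦ ?_)
          fun _ _ _ ↦ mul_nonneg (majorant_nonneg _ _) (majorant_nonneg _ _)
        rw [mem_filter] at hp' ⊢
        exact ⟨hp'.1, (primPart_eq_of_mul_eq (hS p hp).1 (hS p hp).2.1 (hS p' hp'.1).1
          hp'.2).symm⟩
    _ = ∑ v ∈ V, (∑ p ∈ S with primPart p = v, majorant q p) ^ 2 := by
        rw [← sum_fiberwise_of_maps_to (fun p hp ↦ mem_image_of_mem primPart hp)]
        refine sum_congr rfl fun v _ ↦ ?_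
        rw [sq, sum_mul_sum]
        refine sum_congr rfl fun p hp ↦ ?_
        rw [(mem_filter.1 hp).2]
    _ ≤ ∑ v ∈ V, (decay q ((v.1 : ℝ) * v.2) / √((v.1 : ℝ) * v.2) *
          (40 * density q * omega q)) ^ 2 := by
        refine sum_le_sum fun v hv ↦ ?_
        have h0 : 0 ≤ ∑ p ∈ S with primPart p = v, majorant q p :=
          sum_nonneg fun _ _ ↦ majorant_nonneg _ _
        gcongr
        exact sum_primPart_le hq S hS ⟨(hV v hv).1, (hV v hv).2.1⟩
    _ ≤ ∑ v ∈ V, (40 * density q * omega q) ^ 2 * (decay q v.1 / v.1 * (decay q v.2 / v.2)) := by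
        refine sum_le_sum fun v hv ↦ ?_
        have h1 : (1 : ℝ) ≤ v.1 := by exact_mod_cast (hV v hv).1
        have h2 : (1 : ℝ) ≤ v.2 := by exact_mod_cast (hV v hv).2.1
        rw [mul_pow, mul_comm, div_pow, Real.sq_sqrt (by positivity), div_mul_div_comm]
        have d0 := decay_nonneg q (x := (v.1 : ℝ) * v.2) (by positivity)
        have d1 : decay q ((v.1 : ℝ) * v.2) ≤ decay q v.1 :=
          decay_anti q (by positivity) (le_mul_of_one_le_right (by positivity) h2)
        have d2 : decay q ((v.1 : ℝ) * v.2) ≤ decay q v.2 :=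
          decay_anti q (by positivity) (le_mul_of_one_le_left (by positivity) h1)
        gcongr
        rw [sq]
        exact mul_le_mul d1 d2 d0 (d0.trans d1)
    _ ≤ ∑ v ∈ V.image Prod.fst ×ˢ V.image Prod.snd,
          (40 * density q * omega q) ^ 2 * (decay q v.1 / v.1 * (decay q v.2 / v.2)) := by
        refine sum_le_sum_of_subset_of_nonneg (fun v hv ↦ mem_product.2
          ⟨mem_image_of_mem _ hv, mem_image_of_mem _ hv⟩) fun v _ _ ↦ ?_
        have h1 := decay_nonneg q (x := v.1) (by positivity)
        have h2 := decay_nonneg q (x := v.2) (by positivity)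
        positivity
    _ = (40 * density q * omega q) ^ 2 * ((∑ r ∈ V.image Prod.fst, decay q r / r) *
          ∑ s ∈ V.image Prod.snd, decay q s / s) := by
        rw [← mul_sum, sum_mul_sum, sum_product]
    _ ≤ _ := by
        rw [sq (20 * density q * Real.log q)]
        gcongr
        · exact sum_nonneg fun s _ ↦ div_nonneg (decay_nonneg q (by positivity)) (by positivity)
        · refine sum_coprime_min_div_le hq0 hq2 hωq _ fun r hr ↦ ?_
          obtain ⟨v, hv, rfl⟩ := mem_image.1 hr
          exact (hV v hv).2.2.1
        · refine sum_coprime_min_div_le hq0 hq2 hωq _ fun r hr ↦ ?_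
          obtain ⟨v, hv, rfl⟩ := mem_image.1 hr
          exact (hV v hv).2.2.2

end

/-! ### Off-diagonal terms -/

section

open Finset

/-- The discrete analogue of `∫₀^∞ min(1, y/m) m^(-1/2) dm = 4 √y`. -/
lemma sum_min_div_sqrt_le {y : ℝ} (hy : 0 < y) (N : ℕ) :
    ∑ m ∈ Icc 1 N, min 1 (y / m) / √m ≤ 8 * √y := by
  -- the increments of `8 √y √N / (√N + √y)` dominate the terms, and this function is at most `8 √y`
  suffices h : ∑ m ∈ Icc 1 N, min 1 (y / m) / √m ≤ 8 * √y * (√N / (√N + √y)) by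
    refine h.trans (mul_le_of_le_one_right (by positivity) ?_)
    rw [div_le_one (by positivity)]
    linarith [Real.sqrt_nonneg y]
  induction N with
  | zero => simp
  | succ N ih =>
    rw [sum_Icc_succ_top (by omega)]
    set t := √((N + 1 : ℕ) : ℝ) with ht
    set s := √(N : ℝ) with hs
    set Y := √y with hY
    have ht0 : 0 < t := Real.sqrt_pos.2 (by positivity)
    have hs0 : 0 ≤ s := Real.sqrt_nonneg _
    have hY0 : 0 < Y := Real.sqrt_pos.2 hy
    have ht2 : ((N + 1 : ℕ) : ℝ) = t ^ 2 := (Real.sq_sqrt (by positivity)).symm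
    have hs2 : (N : ℝ) = s ^ 2 := (Real.sq_sqrt (by positivity)).symm
    have hy2 : y = Y ^ 2 := (Real.sq_sqrt hy.le).symm
    have hst : t ^ 2 - s ^ 2 = 1 := by rw [← ht2, ← hs2]; push_cast; ring
    have hle : s ≤ t := by nlinarith
    have hdiff : 1 / (2 * t) ≤ t - s := by
      rw [div_le_iff₀ (by positivity)]
      nlinarith
    have key : min 1 (y / ((N + 1 : ℕ) : ℝ)) / t ≤ 8 * Y * (t / (t + Y) - s / (s + Y)) := by
      have h1 : t / (t + Y) - s / (s + Y) = Y * (t - s) / ((t + Y) * (s + Y)) := by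
        field_simp; ring
      have h2 : Y * (1 / (2 * t)) / ((t + Y) * (t + Y)) ≤ Y * (t - s) / ((t + Y) * (s + Y)) := by
        gcongr
      have h3 : min 1 (y / ((N + 1 : ℕ) : ℝ)) ≤ 4 * Y ^ 2 / ((t + Y) * (t + Y)) := by
        rw [le_div_iff₀ (by positivity), ht2, hy2]
        rcases le_total t Y with h | h
        · calc _ ≤ 1 * ((Y + Y) * (Y + Y)) := by gcongr; exact min_le_left _ _
            _ = _ := by ring
        · calc _ ≤ Y ^ 2 / t ^ 2 * ((t + t) * (t + t)) := by gcongr; exact min_le_right _ _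
            _ = _ := by field_simp; ring
      calc min 1 (y / ((N + 1 : ℕ) : ℝ)) / t ≤ 4 * Y ^ 2 / ((t + Y) * (t + Y)) / t := by gcongr
        _ = 8 * Y * (Y * (1 / (2 * t)) / ((t + Y) * (t + Y))) := by field_simp; ring
        _ ≤ _ := by rw [h1]; gcongr
    linarith

/-- An antitone function summed over part of a residue class modulo `k` is at most `1/k` times its
full sum, if the elements are at least `k`: every `c` is charged to the block `(c - k, c]`. -/
lemma mul_sum_le_of_modEq {k M : ℕ} (A : Finset ℕ) (hA : ∀ c ∈ A, k ≤ c ∧ c ≤ M)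
    (hAk : ∀ c ∈ A, ∀ c' ∈ A, c ≡ c' [MOD k]) {F : ℕ → ℝ} (hF0 : ∀ m, 0 ≤ F m)
    (hF : ∀ m n, 0 < m → m ≤ n → F n ≤ F m) :
    k * ∑ c ∈ A, F c ≤ ∑ m ∈ Icc 1 M, F m := by
  -- distinct elements of `A` differ by at least `k`
  have hdisj : (A : Set ℕ).PairwiseDisjoint fun c ↦ Ioc (c - k) c := by
    intro c hc c' hc' hne
    rw [Function.onFun, disjoint_left]
    intro m h1 h2
    rw [mem_Ioc] at h1 h2
    have hkc := (hA c hc).1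
    have hkc' := (hA c' hc').1
    rcases lt_or_gt_of_ne hne with h | h
    · have := Nat.le_of_dvd (by omega) ((Nat.modEq_iff_dvd' h.le).1 (hAk c hc c' hc'))
      omega
    · have := Nat.le_of_dvd (by omega) ((Nat.modEq_iff_dvd' h.le).1 (hAk c' hc' c hc))
      omega
  calc k * ∑ c ∈ A, F c = ∑ c ∈ A, ∑ m ∈ Ioc (c - k) c, F c := by
        rw [mul_sum]
        refine sum_congr rfl fun c hc ↦ ?_
        rw [sum_const, Nat.card_Ioc, nsmul_eq_mul, Nat.sub_sub_self (hA c hc).1]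
    _ ≤ ∑ c ∈ A, ∑ m ∈ Ioc (c - k) c, F m := by
        refine sum_le_sum fun c hc ↦ sum_le_sum fun m hm ↦ ?_
        rw [mem_Ioc] at hm
        exact hF m c (by omega) hm.2
    _ = ∑ m ∈ A.biUnion fun c ↦ Ioc (c - k) c, F m := (sum_biUnion hdisj).symm
    _ ≤ _ := by
        refine sum_le_sum_of_subset_of_nonneg (fun m hm ↦ ?_) fun _ _ _ ↦ hF0 _
        obtain ⟨c, hc, hm⟩ := mem_biUnion.1 hm
        rw [mem_Ioc] at hm
        have := hA c hc
        exact mem_Icc.2 ⟨by omega, by omega⟩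

/-- The condition `d ∣ b c + q l` puts `c` in one residue class modulo `d / gcd(b, d)`, and `d ≤ c`
makes `mul_sum_le_of_modEq` applicable. -/
lemma sum_congruence_le {q : ℕ} (hq : 2 ≤ q) {b d : ℕ} (hd : 0 < d) (l M : ℕ) :
    ∑ c ∈ Icc 1 M with d ≤ c ∧ d ∣ b * c + q * l, decay q ((c : ℝ) * d) / √((c : ℝ) * d) ≤
      b.gcd d / d * (8 * √q / d) := by
  have hd0 : (0 : ℝ) < d := by exact_mod_cast hd
  have hq0 : (0 : ℝ) < q := by exact_mod_cast (by omega : 0 < q)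
  set g := b.gcd d with hg
  have hg0 : 0 < g := Nat.gcd_pos_of_pos_right _ hd
  have hg0' : (0 : ℝ) < g := by exact_mod_cast hg0
  obtain ⟨k, hk⟩ : g ∣ d := Nat.gcd_dvd_right ..
  have hk0 : 0 < k := Nat.pos_of_mul_pos_left (hk ▸ hd)
  have hk0' : (0 : ℝ) < k := by exact_mod_cast hk0
  have hkd : k ≤ d := hk ▸ Nat.le_mul_of_pos_left _ hg0
  have hdk : (d : ℝ) = g * k := by exact_mod_cast hk
  have h := mul_sum_le_of_modEq (k := k) (M := M)
    ({c ∈ Icc 1 M | d ≤ c ∧ d ∣ b * c + q * l}) ?_ ?_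
    (F := fun c ↦ decay q ((c : ℝ) * d) / √((c : ℝ) * d)) ?_ ?_
  · have hroot := sum_min_div_sqrt_le (y := q / d) (by positivity) M
    have hsum : ∑ m ∈ Icc 1 M, decay q ((m : ℝ) * d) / √((m : ℝ) * d) ≤ 8 * √q / d := by
      calc _ = (∑ m ∈ Icc 1 M, min 1 (q / d / m : ℝ) / √m) / √d := by
            rw [sum_div]
            refine sum_congr rfl fun m _ ↦ ?_
            rw [decay, div_div, div_div, mul_comm (d : ℝ), Real.sqrt_mul (by positivity)]
        _ ≤ 8 * √(q / d) / √d := by gcongr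
        _ = 8 * √q / d := by
            rw [Real.sqrt_div' _ hd0.le, mul_div_assoc, div_div, Real.mul_self_sqrt hd0.le,
              mul_div_assoc]
    calc _ = (g : ℝ) / d * (k * ∑ c ∈ Icc 1 M with d ≤ c ∧ d ∣ b * c + q * l,
            decay q ((c : ℝ) * d) / √((c : ℝ) * d)) := by
          rw [← mul_assoc, div_mul_eq_mul_div, hdk, div_self (by positivity), one_mul]
      _ ≤ _ := by gcongr; exact h.trans hsum
  · intro c hc
    simp only [mem_filter, mem_Icc] at hc
    omega
  · intro c hc c' hc'
    simp only [mem_filter, mem_Icc] at hc hc'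
    have h1 : b * c ≡ b * c' [MOD d] := by
      refine Nat.ModEq.add_right_cancel' (q * l) ?_
      exact ((Nat.modEq_zero_iff_dvd).2 hc.2.2).trans ((Nat.modEq_zero_iff_dvd).2 hc'.2.2).symm
    have h2 := h1.cancel_left_div_gcd hd
    rwa [Nat.gcd_comm, ← hg, hk, Nat.mul_div_cancel_left _ hg0] at h2
  · intro m
    exact div_nonneg (decay_nonneg q (by positivity)) (by positivity)
  · intro m n hm hmn
    have hm' : (0 : ℝ) < m := by exact_mod_cast hm
    have hmn' : (m : ℝ) ≤ n := by exact_mod_cast hmn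
    have := decay_nonneg q (x := (m : ℝ) * d) (by positivity)
    have := decay_anti q (x := (m : ℝ) * d) (y := (n : ℝ) * d) (by positivity) (by gcongr)
    gcongr

lemma sum_multiples_le {t : ℝ} (ht : 0 < t) {g : ℕ} (hg : 0 < g) (L : ℕ) :
    ∑ l ∈ Icc 1 L with g ∣ l, min 1 (t / l) / √l ≤ 8 * √t / g := by
  have hg0 : (0 : ℝ) < g := by exact_mod_cast hg
  calc ∑ l ∈ Icc 1 L with g ∣ l, min 1 (t / l) / √l
      ≤ ∑ l ∈ (Icc 1 L).image (g * ·), min 1 (t / l) / √l := by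
        refine sum_le_sum_of_subset_of_nonneg (fun l hl ↦ ?_) fun _ _ _ ↦ by positivity
        rw [mem_filter, mem_Icc] at hl
        obtain ⟨hl, m, rfl⟩ := hl
        exact mem_image_of_mem _ (mem_Icc.2 ⟨Nat.pos_of_mul_pos_left hl.1,
          (Nat.le_mul_of_pos_left _ hg).trans hl.2⟩)
    _ = ∑ m ∈ Icc 1 L, min 1 (t / ((g * m : ℕ) : ℝ)) / √((g * m : ℕ) : ℝ) :=
        sum_image fun a _ b _ h ↦ Nat.eq_of_mul_eq_mul_left hg h
    _ = (∑ m ∈ Icc 1 L, min 1 (t / g / m) / √m) / √g := by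
        rw [sum_div]
        refine sum_congr rfl fun m _ ↦ ?_
        rw [Nat.cast_mul, Real.sqrt_mul hg0.le, div_div, div_div, mul_comm √(g : ℝ)]
    _ ≤ 8 * √(t / g) / √g := by
        gcongr
        exact sum_min_div_sqrt_le (by positivity) L
    _ = 8 * √t / g := by
        rw [Real.sqrt_div' _ hg0.le, mul_div_assoc, div_div, Real.mul_self_sqrt hg0.le,
          mul_div_assoc]

/-- A bound for an off-diagonal term that no longer involves `a`. One of the three factors
`decay q (ab)` is kept for the sum over `l`, one of the factors `decay q (cd)` for the sum over `c`,
and the rest gives convergence in `b` and `d`. -/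
lemma majorant_mul_le {q : ℕ} (hq : 2 ≤ q) {a b c d l : ℕ} (ha : 0 < a) (hb : 0 < b) (hc : 0 < c)
    (hd : 0 < d) (hl : 0 < l) (h : a * d = b * c + q * l) :
    majorant q (a, b) * majorant q (c, d) ≤
      √(d / (b * q)) * (decay q b * decay q d) *
        (min 1 ((d / b : ℝ) / l) / √l * (decay q ((c : ℝ) * d) / √((c : ℝ) * d))) := by
  have ha' : (1 : ℝ) ≤ a := by exact_mod_cast ha
  have hb' : (1 : ℝ) ≤ b := by exact_mod_cast hb
  have hc' : (1 : ℝ) ≤ c := by exact_mod_cast hc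
  have hd' : (1 : ℝ) ≤ d := by exact_mod_cast hd
  have hl' : (1 : ℝ) ≤ l := by exact_mod_cast hl
  have hq' : (2 : ℝ) ≤ q := by exact_mod_cast hq
  have hqa : (q : ℝ) * l ≤ a * d := by exact_mod_cast (by omega : q * l ≤ a * d)
  simp only [majorant]
  set x := (a : ℝ) * b
  have hx : 0 < x := by positivity
  have u0 := decay_nonneg q hx.le
  have u1 : decay q x ≤ min 1 ((d / b : ℝ) / l) := by
    refine min_le_min le_rfl ?_
    rw [div_div, div_le_div_iff₀ hx (by positivity)]
    calc (q : ℝ) * (b * l) = b * (q * l) := by ring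
      _ ≤ b * (a * d) := by gcongr
      _ = _ := by simp only [x]; ring
  have u2 : decay q x ≤ min 1 (d / b : ℝ) :=
    u1.trans (min_le_min le_rfl (div_le_self (by positivity) hl'))
  have u3 := decay_le_one q x
  set z := (c : ℝ) * d
  have hz : 0 < z := by positivity
  have v0 := decay_nonneg q hz.le
  have v1 : decay q z ≤ decay q d :=
    decay_anti q (by positivity) (le_mul_of_one_le_left (by positivity) hc')
  have w0 := decay_nonneg q (x := b) (by positivity)
  have w1 := decay_nonneg q (x := d) (by positivity)
  have hsq : 1 / √x ≤ √(d / (b * q)) / √l := by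
    rw [← Real.sqrt_div' _ (by positivity : (0 : ℝ) ≤ l), ← Real.sqrt_one,
      ← Real.sqrt_div' _ hx.le]
    refine Real.sqrt_le_sqrt ?_
    rw [div_div, div_le_div_iff₀ hx (by positivity)]
    calc 1 * ((b : ℝ) * q * l) = b * (q * l) := by ring
      _ ≤ b * (a * d) := by gcongr
      _ = _ := by simp only [x]; ring
  have hu : decay q x ^ 3 ≤ min 1 ((d / b : ℝ) / l) * min 1 (d / b : ℝ) := by
    calc decay q x ^ 3 = decay q x * decay q x * decay q x := by ring
      _ ≤ min 1 ((d / b : ℝ) / l) * min 1 (d / b : ℝ) * 1 := by gcongr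
      _ = _ := mul_one _
  have hv : decay q z ^ 3 ≤ decay q d * decay q d * decay q z := by
    calc decay q z ^ 3 = decay q z * decay q z * decay q z := by ring
      _ ≤ _ := by gcongr
  have hbd := min_div_mul_decay_le q (b := b) (d := d) (by positivity) (by positivity)
  have hm : 0 ≤ min 1 ((d / b : ℝ) / l) := by positivity
  calc decay q x ^ 3 / √x * (decay q z ^ 3 / √z)
      = decay q x ^ 3 * decay q z ^ 3 * (1 / √x) / √z := by ring
    _ ≤ (min 1 ((d / b : ℝ) / l) * min 1 (d / b : ℝ)) * (decay q d * decay q d * decay q z) *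
          (√(d / (b * q)) / √l) / √z := by gcongr
    _ = √(d / (b * q)) * ((min 1 (d / b : ℝ) * decay q d) * decay q d) *
        (min 1 ((d / b : ℝ) / l) / √l * (decay q z / √z)) := by ring
    _ ≤ _ := by gcongr

/-- The sum over `c` gains `gcd(b, d)`, which is lost again in the sum over `l`, since a solution
exists only if `gcd(b, d) ∣ l`. -/
lemma sum_offDiagonal_inner_le {q : ℕ} (hq : 2 ≤ q) {b d : ℕ} (hb : 0 < b) (hd : 0 < d)
    (hdq : d.Coprime q) (L M : ℕ) :
    ∑ l ∈ Icc 1 L, ∑ c ∈ Icc 1 M with d ≤ c ∧ d ∣ b * c + q * l,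
      √(d / (b * q)) * (decay q b * decay q d) *
        (min 1 ((d / b : ℝ) / l) / √l * (decay q ((c : ℝ) * d) / √((c : ℝ) * d))) ≤
      64 * (decay q b / b * (decay q d / d)) := by
  have hb0 : (0 : ℝ) < b := by exact_mod_cast hb
  have hd0 : (0 : ℝ) < d := by exact_mod_cast hd
  have hq0 : (0 : ℝ) < q := by exact_mod_cast (by omega : 0 < q)
  have w0 := decay_nonneg q hb0.le
  have w1 := decay_nonneg q hd0.le
  set g := b.gcd d with hg
  have hg0 : 0 < g := Nat.gcd_pos_of_pos_right _ hd
  have hg0' : (0 : ℝ) < g := by exact_mod_cast hg0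
  have hgdvd {l c : ℕ} (h : d ∣ b * c + q * l) : g ∣ l := by
    have h1 : g ∣ q * l := (Nat.dvd_add_right ((Nat.gcd_dvd_left b d).mul_right c)).1
      ((Nat.gcd_dvd_right b d).trans h)
    exact (hdq.coprime_dvd_left (Nat.gcd_dvd_right b d)).dvd_of_dvd_mul_left h1
  simp_rw [← mul_sum]
  have hinner : ∑ l ∈ Icc 1 L, min 1 ((d / b : ℝ) / l) / √l *
      ∑ c ∈ Icc 1 M with d ≤ c ∧ d ∣ b * c + q * l, decay q ((c : ℝ) * d) / √((c : ℝ) * d) ≤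
      8 * √(d / b) / g * (g / d * (8 * √q / d)) := by
    rw [← sum_filter_add_sum_filter_not (Icc 1 L) (fun l ↦ g ∣ l)]
    rw [sum_eq_zero (s := {l ∈ Icc 1 L | ¬ g ∣ l}), add_zero]
    · refine le_trans (sum_le_sum fun l _ ↦ mul_le_mul_of_nonneg_left
        (sum_congruence_le hq hd l M) (by positivity)) ?_
      rw [← sum_mul]
      gcongr
      exact sum_multiples_le (by positivity) hg0 L
    · intro l hl
      rw [filter_false_of_mem, sum_empty, mul_zero]
      rintro c - ⟨-, h⟩
      exact (mem_filter.1 hl).2 (hgdvd h)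
  calc _ ≤ √(d / (b * q)) * (decay q b * decay q d) *
        (8 * √(d / b) / g * (g / d * (8 * √q / d))) := by gcongr
    _ = _ := by
      rw [mul_comm (b : ℝ) q, ← div_div, div_right_comm, Real.sqrt_div' _ hq0.le]
      have h1 : √(d / b : ℝ) * √(d / b : ℝ) = d / b := Real.mul_self_sqrt (by positivity)
      have h2 : √(q : ℝ) ≠ 0 := (Real.sqrt_pos.2 hq0).ne'
      calc _ = 64 * ((√(d / b : ℝ) * √(d / b : ℝ)) * (decay q b * decay q d)) *
            (√(q : ℝ) / √(q : ℝ)) * ((g : ℝ) / g) / (d * d) := by ring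
        _ = _ := by
          rw [h1, div_self h2, div_self hg0'.ne']
          field_simp

/-- The quadruples inject into the `(b, d, l, c)` with `d ∣ b c + q l`, where `a d = b c + q l`. -/
theorem offDiagonal_le {q : ℕ} (hq : 2 ≤ q) (S : Finset (ℕ × ℕ))
    (hS : ∀ p ∈ S, 0 < p.2 ∧ p.2 ≤ p.1 ∧ p.2.Coprime q) :
    ∑ p ∈ S, ∑ p' ∈ S with p.2 * p'.1 < p.1 * p'.2 ∧ p.2 * p'.1 ≡ p.1 * p'.2 [MOD q],
      majorant q p * majorant q p' ≤ 64 * (20 * Real.log q) ^ 2 := by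
  have hq2 : (2 : ℝ) ≤ q := by exact_mod_cast hq
  set M := S.sup Prod.fst
  have hM (p : ℕ × ℕ) (hp : p ∈ S) : p.1 ≤ M := Finset.le_sup (f := Prod.fst) hp
  set X : Finset ((ℕ × ℕ) × (ℕ × ℕ)) :=
    {x ∈ S ×ˢ S | x.1.2 * x.2.1 < x.1.1 * x.2.2 ∧ x.1.2 * x.2.1 ≡ x.1.1 * x.2.2 [MOD q]} with hX
  set T : Finset (ℕ × ℕ × ℕ × ℕ) :=
    {y ∈ Icc 1 M ×ˢ Icc 1 M ×ˢ Icc 1 (M * M) ×ˢ Icc 1 M |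
      y.2.1.Coprime q ∧ y.2.1 ≤ y.2.2.2 ∧ y.2.1 ∣ y.1 * y.2.2.2 + q * y.2.2.1} with hT
  set i : (ℕ × ℕ) × (ℕ × ℕ) → ℕ × ℕ × ℕ × ℕ :=
    fun x ↦ (x.1.2, x.2.2, (x.1.1 * x.2.2 - x.1.2 * x.2.1) / q, x.2.1) with hi
  set H : ℕ × ℕ × ℕ × ℕ → ℝ := fun y ↦
    √(y.2.1 / (y.1 * q)) * (decay q y.1 * decay q y.2.1) *
        (min 1 ((y.2.1 / y.1 : ℝ) / y.2.2.1) / √y.2.2.1 *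
          (decay q ((y.2.2.2 : ℝ) * y.2.1) / √((y.2.2.2 : ℝ) * y.2.1))) with hH
  have hH0 (y) : 0 ≤ H y := by
    have h1 := decay_nonneg q (x := y.1) (by positivity)
    have h2 := decay_nonneg q (x := y.2.1) (by positivity)
    have h3 := decay_nonneg q (x := (y.2.2.2 : ℝ) * y.2.1) (by positivity)
    simp only [hH]
    positivity
  have heq (x) (hx : x ∈ X) : 0 < (x.1.1 * x.2.2 - x.1.2 * x.2.1) / q ∧
      x.1.1 * x.2.2 = x.1.2 * x.2.1 + q * ((x.1.1 * x.2.2 - x.1.2 * x.2.1) / q) := by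
    rw [hX, mem_filter] at hx
    have hdvd := (Nat.modEq_iff_dvd' hx.2.1.le).1 hx.2.2
    refine ⟨Nat.div_pos (Nat.le_of_dvd (by omega) hdvd) (by omega), ?_⟩
    rw [Nat.mul_div_cancel' hdvd]
    omega
  calc _ = ∑ x ∈ X, majorant q x.1 * majorant q x.2 := by
        rw [hX, sum_filter, sum_product]
        simp_rw [sum_filter]
    _ ≤ ∑ x ∈ X, H (i x) := by
        refine sum_le_sum fun x hx ↦ ?_
        have hx' := mem_product.1 (mem_filter.1 hx).1
        obtain ⟨h1, h2, -⟩ := hS _ hx'.1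
        obtain ⟨h3, h4, -⟩ := hS _ hx'.2
        obtain ⟨hl, he⟩ := heq x hx
        exact majorant_mul_le hq (h1.trans_le h2) h1 (h3.trans_le h4) h3 hl he
    _ = ∑ y ∈ X.image i, H y := by
        rw [sum_image]
        intro x hx y hy hxy
        simp only [hi, Prod.mk.injEq] at hxy
        obtain ⟨e1, e2, e3, e4⟩ := hxy
        have hx1 := (heq x hx).2
        have hy1 := (heq y hy).2
        rw [e3, e1, e4, ← hy1, e2] at hx1
        have hpos : 0 < y.2.2 := (hS _ (mem_product.1 (mem_filter.1 hy).1).2).1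
        exact Prod.ext (Prod.ext (Nat.eq_of_mul_eq_mul_right hpos hx1) e1) (Prod.ext e4 e2)
    _ ≤ ∑ y ∈ T, H y := by
        refine sum_le_sum_of_subset_of_nonneg (fun y hy ↦ ?_) fun _ _ _ ↦ hH0 _
        obtain ⟨x, hx, rfl⟩ := mem_image.1 hy
        have hx' := mem_product.1 (mem_filter.1 hx).1
        obtain ⟨h1, h2, -⟩ := hS _ hx'.1
        obtain ⟨h3, h4, h5⟩ := hS _ hx'.2
        obtain ⟨hl, he⟩ := heq x hx
        have hM1 := hM _ hx'.1
        have hM2 := hM _ hx'.2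
        simp only [hT, hi, mem_filter, mem_product, mem_Icc]
        refine ⟨⟨⟨h1, h2.trans hM1⟩, ⟨h3, h4.trans hM2⟩, ⟨hl, ?_⟩, ⟨h3.trans_le h4, hM2⟩⟩, h5, h4,
          Dvd.intro_left _ he⟩
        refine (Nat.div_le_self ..).trans ((Nat.sub_le ..).trans ?_)
        exact Nat.mul_le_mul hM1 (h4.trans hM2)
    _ = ∑ b ∈ Icc 1 M, ∑ d ∈ Icc 1 M with d.Coprime q, ∑ l ∈ Icc 1 (M * M),
          ∑ c ∈ Icc 1 M with d ≤ c ∧ d ∣ b * c + q * l, H (b, d, l, c) := by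
        rw [hT, sum_filter, sum_product]
        refine sum_congr rfl fun b _ ↦ ?_
        rw [sum_product, sum_filter]
        refine sum_congr rfl fun d _ ↦ ?_
        rw [sum_product]
        split_ifs with h
        · refine sum_congr rfl fun l _ ↦ ?_
          rw [sum_filter]
          exact sum_congr rfl fun c _ ↦ if_congr (and_iff_right h) rfl rfl
        · simp [h]
    _ ≤ ∑ b ∈ Icc 1 M, ∑ d ∈ Icc 1 M with d.Coprime q,
          64 * (decay q b / b * (decay q d / d)) := by
        refine sum_le_sum fun b hb ↦ sum_le_sum fun d hd ↦ ?_
        rw [mem_filter, mem_Icc] at hd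
        exact sum_offDiagonal_inner_le hq (mem_Icc.1 hb).1 hd.1.1 hd.2 _ _
    _ = 64 * ((∑ b ∈ Icc 1 M, decay q b / b) *
          ∑ d ∈ Icc 1 M with d.Coprime q, decay q d / d) := by
        rw [sum_mul_sum, mul_sum]
        simp_rw [mul_sum]
    _ ≤ _ := by
        rw [sq]
        gcongr
        · exact sum_nonneg fun s _ ↦ div_nonneg (decay_nonneg q (by positivity)) (by positivity)
        · exact sum_min_div_le hq2 _
        · exact sum_min_div_le hq2 _

end

/-! ### Orthogonality and the mean square of finite sums -/

section

open Finset ComplexConjugate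

lemma conj_apply_eq_apply_inv {q : ℕ} (χ : DirichletCharacter ℂ q) {u : ZMod q} (hu : IsUnit u) :
    conj (χ u) = χ u⁻¹ := by
  have h1 : χ u * conj (χ u) = 1 := by
    rw [Complex.mul_conj, Complex.normSq_eq_norm_sq, ← hu.unit_spec,
      DirichletCharacter.unit_norm_eq_one]
    simp
  have h2 : χ u * χ u⁻¹ = 1 := by
    rw [← map_mul, ZMod.mul_inv_of_unit _ hu, map_one]
  exact mul_left_cancel₀ (left_ne_zero_of_mul_eq_one h1) (h1.trans h2.symm)

/-- The pair sum `∑ w(a, b) χ(a) χ̄(b)` over a finite set of pairs. -/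
def pairSum {q : ℕ} (χ : DirichletCharacter ℂ q) (S : Finset (ℕ × ℕ)) (w : ℕ × ℕ → ℝ) : ℂ :=
  ∑ p ∈ S, (w p : ℂ) * (χ (p.1 : ZMod q) * conj (χ (p.2 : ZMod q)))

/-- Orthogonality of characters. -/
theorem sum_norm_sq_pairSum {q : ℕ} [NeZero q] (S : Finset (ℕ × ℕ)) (w : ℕ × ℕ → ℝ)
    (hS : ∀ p ∈ S, p.1.Coprime q ∧ p.2.Coprime q) :
    ∑ χ : DirichletCharacter ℂ q, ‖pairSum χ S w‖ ^ 2 =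
      q.totient * ∑ p ∈ S, ∑ p' ∈ S with p.2 * p'.1 ≡ p.1 * p'.2 [MOD q], w p * w p' := by
  have key : ∑ χ : DirichletCharacter ℂ q, ((‖pairSum χ S w‖ ^ 2 : ℝ) : ℂ) =
      ∑ p ∈ S, ∑ p' ∈ S, ((w p * w p' : ℝ) : ℂ) *
        ∑ χ : DirichletCharacter ℂ q,
          χ ((p.2 * p'.1 : ℕ) : ZMod q)⁻¹ * χ ((p.1 * p'.2 : ℕ) : ZMod q) := by
    simp_rw [mul_sum]
    rw [sum_congr rfl fun p _ ↦ sum_comm, sum_comm]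
    refine sum_congr rfl fun χ _ ↦ ?_
    rw [← Complex.normSq_eq_norm_sq, ← Complex.mul_conj, pairSum, map_sum, sum_mul_sum]
    refine sum_congr rfl fun p hp ↦ sum_congr rfl fun p' hp' ↦ ?_
    have hu : IsUnit ((p.2 * p'.1 : ℕ) : ZMod q) :=
      (ZMod.isUnit_iff_coprime _ _).2 (Nat.Coprime.mul_left (hS p hp).2 (hS p' hp').1)
    rw [← conj_apply_eq_apply_inv χ hu]
    push_cast
    simp only [map_mul, Complex.conj_ofReal, Complex.conj_conj]
    ring
  have hval (p : ℕ × ℕ) (hp : p ∈ S) (p' : ℕ × ℕ) (hp' : p' ∈ S) :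
      ∑ χ : DirichletCharacter ℂ q,
          χ ((p.2 * p'.1 : ℕ) : ZMod q)⁻¹ * χ ((p.1 * p'.2 : ℕ) : ZMod q) =
        if p.2 * p'.1 ≡ p.1 * p'.2 [MOD q] then (q.totient : ℂ) else 0 := by
    have hu : IsUnit ((p.2 * p'.1 : ℕ) : ZMod q) :=
      (ZMod.isUnit_iff_coprime _ _).2 (Nat.Coprime.mul_left (hS p hp).2 (hS p' hp').1)
    rw [DirichletCharacter.sum_char_inv_mul_char_eq ℂ hu]
    exact if_congr (ZMod.natCast_eq_natCast_iff ..) rfl rfl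
  rw [← Complex.ofReal_inj]
  push_cast at key ⊢
  rw [key, mul_sum]
  refine sum_congr rfl fun p hp ↦ ?_
  rw [sum_filter, mul_sum]
  refine sum_congr rfl fun p' hp' ↦ ?_
  have := hval p hp p' hp'
  push_cast at this
  rw [this]
  split_ifs
  · ring
  · simp

/-- The bound `φ(q) (diagonal + 2 · off-diagonal)` resulting from `diagonal_le` and
`offDiagonal_le`. -/
def tailBound (q : ℕ) : ℝ :=
  q.totient * ((40 * density q * omega q) ^ 2 * (20 * density q * Real.log q) ^ 2 +
    2 * (64 * (20 * Real.log q) ^ 2))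

/-- The mean square over pairs `(a, b)` with `b ≤ a`. -/
lemma sum_norm_sq_pairSum_ordered_le {q : ℕ} [NeZero q] (hq : 2 ≤ q) {B : ℝ} (S : Finset (ℕ × ℕ))
    (w : ℕ × ℕ → ℝ) (hw : ∀ p ∈ S, |w p| ≤ B * majorant q p)
    (hS : ∀ p ∈ S, 0 < p.2 ∧ p.2 ≤ p.1 ∧ cutoff q < (p.1 : ℝ) * p.2) :
    ∑ χ : DirichletCharacter ℂ q, ‖pairSum χ S w‖ ^ 2 ≤ B ^ 2 * tailBound q := by
  -- characters vanish off the units, so only pairs coprime to `q` matter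
  set S' := {p ∈ S | p.1.Coprime q ∧ p.2.Coprime q} with hS'
  have hmem {p : ℕ × ℕ} (hp : p ∈ S') : p ∈ S ∧ p.1.Coprime q ∧ p.2.Coprime q :=
    mem_filter.1 hp
  have hred (χ : DirichletCharacter ℂ q) : pairSum χ S w = pairSum χ S' w := by
    refine (sum_subset (filter_subset _ _) fun p hp hp' ↦ ?_).symm
    have h : ¬ (IsUnit (p.1 : ZMod q) ∧ IsUnit (p.2 : ZMod q)) := by
      rw [ZMod.isUnit_iff_coprime, ZMod.isUnit_iff_coprime]
      exact fun h ↦ hp' (mem_filter.2 ⟨hp, h⟩)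
    rcases not_and_or.1 h with h | h <;> simp [χ.map_nonunit h]
  simp_rw [hred]
  rw [sum_norm_sq_pairSum S' w fun p hp ↦ (hmem hp).2, tailBound, mul_left_comm]
  gcongr
  have hdiag := diagonal_le hq S' fun p hp ↦ ⟨(hS p (hmem hp).1).1.trans_le (hS p (hmem hp).1).2.1,
    (hS p (hmem hp).1).1, (hmem hp).2.1, (hmem hp).2.2, (hS p (hmem hp).1).2.2⟩
  have hoff := offDiagonal_le hq S' fun p hp ↦ ⟨(hS p (hmem hp).1).1, (hS p (hmem hp).1).2.1,
    (hmem hp).2.2⟩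
  have hoff' : ∑ p ∈ S', ∑ p' ∈ S' with p.1 * p'.2 < p.2 * p'.1 ∧ p.2 * p'.1 ≡ p.1 * p'.2 [MOD q],
      majorant q p * majorant q p' ≤ 64 * (20 * Real.log q) ^ 2 := by
    refine le_trans (le_of_eq ?_) hoff
    simp_rw [sum_filter]
    rw [sum_comm]
    refine sum_congr rfl fun p _ ↦ sum_congr rfl fun p' _ ↦ ?_
    rw [mul_comm (majorant q p'), mul_comm p'.1, mul_comm p'.2]
    exact if_congr (and_congr_right fun _ ↦ ⟨Nat.ModEq.symm, Nat.ModEq.symm⟩) rfl rfl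
  calc ∑ p ∈ S', ∑ p' ∈ S' with p.2 * p'.1 ≡ p.1 * p'.2 [MOD q], w p * w p'
      ≤ ∑ p ∈ S', ∑ p' ∈ S' with p.2 * p'.1 ≡ p.1 * p'.2 [MOD q],
          B ^ 2 * (majorant q p * majorant q p') := by
        refine sum_le_sum fun p hp ↦ sum_le_sum fun p' hp' ↦ ?_
        calc w p * w p' ≤ |w p| * |w p'| := by rw [← abs_mul]; exact le_abs_self _
          _ ≤ (B * majorant q p) * (B * majorant q p') := by
            have h1 := hw p (hmem hp).1
            gcongr
            · exact (abs_nonneg _).trans h1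
            · exact hw p' (hmem (mem_filter.1 hp').1).1
          _ = _ := by ring
    _ = B ^ 2 * ((∑ p ∈ S', ∑ p' ∈ S' with p.1 * p'.2 = p.2 * p'.1, majorant q p * majorant q p') +
          ((∑ p ∈ S', ∑ p' ∈ S' with
            p.2 * p'.1 < p.1 * p'.2 ∧ p.2 * p'.1 ≡ p.1 * p'.2 [MOD q],
              majorant q p * majorant q p') +
          ∑ p ∈ S', ∑ p' ∈ S' with
            p.1 * p'.2 < p.2 * p'.1 ∧ p.2 * p'.1 ≡ p.1 * p'.2 [MOD q],
              majorant q p * majorant q p')) := by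
        rw [sum_congr rfl fun p _ ↦ (mul_sum _ _ _).symm, ← mul_sum]
        congr 1
        rw [← sum_add_distrib, ← sum_add_distrib]
        refine sum_congr rfl fun p _ ↦ ?_
        simp_rw [sum_filter]
        rw [← sum_add_distrib, ← sum_add_distrib]
        refine sum_congr rfl fun p' _ ↦ ?_
        rcases lt_trichotomy (p.1 * p'.2) (p.2 * p'.1) with h | h | h
        · simp [h, h.ne, h.not_gt]
        · simp [h, Nat.ModEq.refl]
        · simp [h, h.ne', h.not_gt]
    _ ≤ _ := by
        gcongr
        linarith

/-- The pairs with `a < b` are exchanged with those with `b < a` by complex conjugation. -/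
theorem sum_norm_sq_pairSum_le {q : ℕ} [NeZero q] (hq : 2 ≤ q) {B : ℝ} (S : Finset (ℕ × ℕ))
    (w : ℕ × ℕ → ℝ) (hw : ∀ p ∈ S, |w p| ≤ B * majorant q p)
    (hS : ∀ p ∈ S, 0 < p.1 ∧ 0 < p.2 ∧ cutoff q < (p.1 : ℝ) * p.2) :
    ∑ χ : DirichletCharacter ℂ q, ‖pairSum χ S w‖ ^ 2 ≤ 4 * (B ^ 2 * tailBound q) := by
  set S₁ := {p ∈ S | p.2 ≤ p.1}
  set S₂ := {p ∈ S | ¬ p.2 ≤ p.1}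
  have hswap (χ : DirichletCharacter ℂ q) :
      ‖pairSum χ S₂ w‖ = ‖pairSum χ (S₂.image Prod.swap) (w ∘ Prod.swap)‖ := by
    rw [← Complex.norm_conj, pairSum, pairSum, map_sum, sum_image Prod.swap_injective.injOn]
    congr 1
    refine sum_congr rfl fun p _ ↦ ?_
    simp [mul_comm]
  have h1 := sum_norm_sq_pairSum_ordered_le hq S₁ w (fun p hp ↦ hw p (mem_filter.1 hp).1)
    fun p hp ↦ ⟨(hS p (mem_filter.1 hp).1).2.1, (mem_filter.1 hp).2,
      (hS p (mem_filter.1 hp).1).2.2⟩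
  have h2 : ∑ χ : DirichletCharacter ℂ q, ‖pairSum χ S₂ w‖ ^ 2 ≤ B ^ 2 * tailBound q := by
    simp_rw [hswap]
    refine sum_norm_sq_pairSum_ordered_le hq _ _ (fun p hp ↦ ?_) fun p hp ↦ ?_
    · obtain ⟨p, hp', rfl⟩ := mem_image.1 hp
      have := hw p (mem_filter.1 hp').1
      simpa [majorant, mul_comm] using this
    · obtain ⟨p, hp', rfl⟩ := mem_image.1 hp
      obtain ⟨hp, hlt⟩ := mem_filter.1 hp'
      refine ⟨(hS p hp).1, (not_le.1 hlt).le, ?_⟩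
      simpa [mul_comm] using (hS p hp).2.2
  calc ∑ χ : DirichletCharacter ℂ q, ‖pairSum χ S w‖ ^ 2
      ≤ ∑ χ : DirichletCharacter ℂ q, (2 * ‖pairSum χ S₁ w‖ ^ 2 + 2 * ‖pairSum χ S₂ w‖ ^ 2) := by
        refine sum_le_sum fun χ _ ↦ ?_
        have hadd : pairSum χ S w = pairSum χ S₁ w + pairSum χ S₂ w :=
          (sum_filter_add_sum_filter_not ..).symm
        have h := norm_add_le (pairSum χ S₁ w) (pairSum χ S₂ w)
        rw [hadd]
        have := pow_le_pow_left₀ (norm_nonneg _) h 2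
        nlinarith [sq_nonneg (‖pairSum χ S₁ w‖ - ‖pairSum χ S₂ w‖)]
    _ = 2 * ∑ χ : DirichletCharacter ℂ q, ‖pairSum χ S₁ w‖ ^ 2 +
          2 * ∑ χ : DirichletCharacter ℂ q, ‖pairSum χ S₂ w‖ ^ 2 := by
        rw [sum_add_distrib, mul_sum, mul_sum]
    _ ≤ _ := by linarith

end

/-! ### Passage to the infinite tail -/

section

open Finset ComplexConjugate

/-- The real coefficient `W_𝔞(π a b / q) / √(ab)` of `χ(a) χ̄(b)`, for the pair `p = (a, b)`. -/
def coeff (q a : ℕ) (p : ℕ × ℕ) : ℝ :=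
  survival a (Real.pi * ((p.1 : ℝ) * p.2) / q) / √((p.1 : ℝ) * p.2)

lemma summand_eq {c : ℝ} (hc : 0 < c) {q : ℕ} [NeZero q] (χ : DirichletCharacter ℂ q)
    (p : ℕ+ × ℕ+) : summand c χ p = (coeff q (parity χ) (p.1, p.2) : ℂ) *
      (χ ((p.1 : ℕ) : ZMod q) * conj (χ ((p.2 : ℕ) : ZMod q))) := by
  have hq : (0 : ℝ) < q := by exact_mod_cast NeZero.pos q
  have h1 : (0 : ℝ) < ((p.1 : ℕ) : ℝ) := by exact_mod_cast p.1.pos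
  have h2 : (0 : ℝ) < ((p.2 : ℕ) : ℝ) := by exact_mod_cast p.2.pos
  rw [summand, weight_eq_survival hc _ (by positivity), coeff]
  push_cast
  ring

lemma exists_coeff_le : ∃ B : ℝ, 0 < B ∧ ∀ a ∈ ({0, 1} : Set ℕ), ∀ q : ℕ, 0 < q →
    ∀ p : ℕ × ℕ, 0 < p.1 → 0 < p.2 → |coeff q a p| ≤ B * majorant q p := by
  obtain ⟨B₀, hB₀, h₀⟩ := exists_survival_le 0
  obtain ⟨B₁, hB₁, h₁⟩ := exists_survival_le 1
  refine ⟨1 + B₀ + B₁, by positivity, fun a ha q hq p hp1 hp2 ↦ ?_⟩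
  have hq' : (0 : ℝ) < q := by exact_mod_cast hq
  have hx : (0 : ℝ) < (p.1 : ℝ) * p.2 := by positivity
  set x := (p.1 : ℝ) * p.2 with hxdef
  have hsurv : survival a (Real.pi * x / q) ≤ (B₀ + B₁) * (q / x) ^ 3 := by
    have hle : x / q ≤ Real.pi * x / q := by
      gcongr
      exact le_mul_of_one_le_left hx.le (by linarith [Real.pi_gt_three])
    have hB : survival a (Real.pi * x / q) ≤ (B₀ + B₁) / (Real.pi * x / q) ^ 3 := by
      rcases ha with rfl | rfl
      · exact (h₀ _ (by positivity)).trans (by gcongr; linarith)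
      · exact (h₁ _ (by positivity)).trans (by gcongr; linarith)
    refine hB.trans ?_
    calc (B₀ + B₁) / (Real.pi * x / q) ^ 3 ≤ (B₀ + B₁) / (x / q) ^ 3 := by gcongr
      _ = _ := by rw [div_eq_mul_inv _ ((x / q) ^ 3), ← inv_pow, inv_div]
  rw [coeff, abs_of_nonneg (div_nonneg (survival_nonneg _ _) (Real.sqrt_nonneg _)), majorant,
    ← mul_div_assoc, decay]
  gcongr
  rcases le_total 1 (q / x) with h | h
  · rw [min_eq_left h]
    have := survival_le_one a (Real.pi * x / q)
    linarith
  · rw [min_eq_right h]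
    refine hsurv.trans ?_
    gcongr
    linarith

lemma parity_mem {q : ℕ} (χ : DirichletCharacter ℂ q) : parity χ ∈ ({0, 1} : Set ℕ) := by
  unfold parity
  split_ifs <;> simp

lemma norm_mul_conj_le_one {q : ℕ} (χ : DirichletCharacter ℂ q) (u v : ZMod q) :
    ‖χ u * conj (χ v)‖ ≤ 1 := by
  rw [norm_mul, Complex.norm_conj]
  exact mul_le_one₀ (χ.norm_le_one u) (norm_nonneg _) (χ.norm_le_one v)

theorem summable_summand {c : ℝ} (hc : 0 < c) {q : ℕ} [NeZero q] (χ : DirichletCharacter ℂ q) :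
    Summable (summand c χ) := by
  obtain ⟨B, hB, h⟩ := exists_coeff_le
  have hs : Summable fun n : ℕ+ ↦ 1 / ((n : ℕ) : ℝ) ^ 2 :=
    (Real.summable_one_div_nat_pow.2 one_lt_two).comp_injective PNat.coe_injective
  have hprod := (hs.mul_of_nonneg hs (fun _ ↦ by positivity) fun _ ↦ by positivity).mul_left
    (B * q ^ 2)
  refine hprod.of_norm_bounded fun p ↦ ?_
  have h1 : (1 : ℝ) ≤ ((p.1 : ℕ) : ℝ) := by exact_mod_cast p.1.pos
  have h2 : (1 : ℝ) ≤ ((p.2 : ℕ) : ℝ) := by exact_mod_cast p.2.pos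
  have hx : 1 ≤ ((p.1 : ℕ) : ℝ) * ((p.2 : ℕ) : ℝ) := one_le_mul_of_one_le_of_one_le h1 h2
  have hw := h _ (parity_mem χ) q (NeZero.pos q) (p.1, p.2) p.1.pos p.2.pos
  set x := ((p.1 : ℕ) : ℝ) * ((p.2 : ℕ) : ℝ) with hxdef
  have d0 := decay_nonneg q (x := x) (by positivity)
  have hmaj : majorant q (p.1, p.2) ≤ (q / x) ^ 2 := by
    calc majorant q (p.1, p.2) ≤ decay q x ^ 3 :=
          div_le_self (by positivity) (Real.one_le_sqrt.2 hx)
      _ ≤ decay q x ^ 2 := pow_le_pow_of_le_one d0 (decay_le_one q x) (by norm_num)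
      _ ≤ (q / x) ^ 2 := by gcongr; exact min_le_right _ _
  rw [summand_eq hc, norm_mul, Complex.norm_real, Real.norm_eq_abs]
  calc _ ≤ |coeff q (parity χ) (p.1, p.2)| * 1 := by
        gcongr; exact norm_mul_conj_le_one ..
    _ ≤ B * (q / x) ^ 2 := by rw [mul_one]; exact hw.trans (by gcongr)
    _ = _ := by simp only [hxdef]; field_simp

/-- Each character is charged to both parities, so that for a fixed weight the sum runs over all
characters. -/
theorem sum_norm_sq_tailSum_le {B : ℝ} (hB : ∀ a ∈ ({0, 1} : Set ℕ), ∀ q : ℕ, 0 < q →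
    ∀ p : ℕ × ℕ, 0 < p.1 → 0 < p.2 → |coeff q a p| ≤ B * majorant q p) {c : ℝ} (hc : 0 < c)
    {q : ℕ} [NeZero q] (hq : 2 ≤ q) :
    ∑ χ : DirichletCharacter ℂ q, ‖tailSum c χ‖ ^ 2 ≤ 8 * (B ^ 2 * tailBound q) := by
  have hlim (χ : DirichletCharacter ℂ q) : Filter.Tendsto
      (fun F : Finset (tailPairs q) ↦ ∑ p ∈ F, summand c χ p) Filter.atTop
      (nhds (tailSum c χ)) :=
    ((summable_summand hc χ).subtype (tailPairs q)).hasSum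
  refine le_of_tendsto (tendsto_finsetSum univ fun χ _ ↦ ((hlim χ).norm.pow 2))
    (.of_forall fun F ↦ ?_)
  set e : tailPairs q → ℕ × ℕ := fun p ↦ (p.1.1, p.1.2) with he
  have he_inj : Function.Injective e := by
    intro p p' h
    simp only [he, Prod.mk.injEq, PNat.coe_inj] at h
    exact Subtype.ext (Prod.ext h.1 h.2)
  have hpair (χ : DirichletCharacter ℂ q) :
      ∑ p ∈ F, summand c χ p = pairSum χ (F.image e) (coeff q (parity χ)) := by
    rw [pairSum, sum_image he_inj.injOn]
    exact sum_congr rfl fun p _ ↦ summand_eq hc χ p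
  have hbound (a : ℕ) (ha : a ∈ ({0, 1} : Set ℕ)) :
      ∑ χ : DirichletCharacter ℂ q, ‖pairSum χ (F.image e) (coeff q a)‖ ^ 2 ≤
        4 * (B ^ 2 * tailBound q) := by
    refine sum_norm_sq_pairSum_le hq _ _ (fun p hp ↦ ?_) fun p hp ↦ ?_ <;>
      obtain ⟨p, hp, rfl⟩ := mem_image.1 hp
    · exact hB a ha q (NeZero.pos q) _ p.1.1.pos p.1.2.pos
    · exact ⟨p.1.1.pos, p.1.2.pos, p.2⟩
  calc ∑ χ : DirichletCharacter ℂ q, ‖∑ p ∈ F, summand c χ p‖ ^ 2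
      ≤ ∑ χ : DirichletCharacter ℂ q, (‖pairSum χ (F.image e) (coeff q 0)‖ ^ 2 +
          ‖pairSum χ (F.image e) (coeff q 1)‖ ^ 2) := by
        refine sum_le_sum fun χ _ ↦ ?_
        rw [hpair]
        rcases parity_mem χ with h | h <;> rw [h]
        · exact le_add_of_nonneg_right (sq_nonneg _)
        · exact le_add_of_nonneg_left (sq_nonneg _)
    _ ≤ _ := by
        rw [sum_add_distrib]
        linarith [hbound 0 (by simp), hbound 1 (by simp)]

lemma tailBound_le {q : ℕ} (hq : 2 ≤ q) :
    tailBound q ≤ 640000 * ((q : ℝ) * ((q.totient : ℝ) / q) ^ 5 * ((omega q : ℝ) * Real.log q) ^ 2 +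
      q * Real.log q ^ 3) := by
  have hq0 : (0 : ℝ) < q := by exact_mod_cast (by omega : 0 < q)
  have hlog : 0.5 ≤ Real.log q := by
    have h1 := Real.log_two_gt_d9
    have h2 : Real.log 2 ≤ Real.log q := Real.log_le_log two_pos (by exact_mod_cast hq)
    linarith
  have hphi : (q.totient : ℝ) = q * density q := by
    rw [density, mul_div_cancel₀ _ hq0.ne']
  have hphi' : (q.totient : ℝ) ≤ q := by exact_mod_cast q.totient_le
  have h1 : (q.totient : ℝ) * Real.log q ^ 2 ≤ q * (2 * Real.log q ^ 3) := by
    gcongr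
    nlinarith [sq_nonneg (Real.log q)]
  have h2 : 0 ≤ (q : ℝ) * Real.log q ^ 3 := by positivity
  have h3 : (q.totient : ℝ) * ((40 * density q * omega q) ^ 2 * (20 * density q * Real.log q) ^ 2) =
      640000 * (q * density q ^ 5 * ((omega q : ℝ) * Real.log q) ^ 2) := by
    rw [hphi]; ring
  rw [tailBound, mul_add, h3, ← density]
  linarith

end

end CharTail

end

theorem proposition2 :
    ∃ K : ℝ, 0 < K ∧ ∀ c : ℝ, 0 < c →
      (∀ a ∈ ({0, 1} : Set ℕ), Complex.VerticalIntegrable (CharTail.weightKernel a) c) ∧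
      ∀ (q : ℕ) [NeZero q], 2 ≤ q →
        (∀ χ : DirichletCharacter ℂ q, Summable (CharTail.summand c χ)) ∧
        ∑ χ : DirichletCharacter ℂ q, ‖CharTail.tailSum c χ‖ ^ 2 ≤
          K * ((q : ℝ) * ((Nat.totient q : ℝ) / (q : ℝ)) ^ 5 *
                ((ArithmeticFunction.cardDistinctFactors q : ℝ) * Real.log (q : ℝ)) ^ 2 +
              (q : ℝ) * Real.log (q : ℝ) ^ 3) := by
  obtain ⟨B, hB0, hB⟩ := CharTail.exists_coeff_le
  refine ⟨8 * B ^ 2 * 640000, by positivity, fun c hc ↦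
    ⟨fun a _ ↦ CharTail.verticalIntegrable_weightKernel a hc, fun q _ hq ↦
      ⟨fun χ ↦ CharTail.summable_summand hc χ, ?_⟩⟩⟩
  refine (CharTail.sum_norm_sq_tailSum_le hB hc hq).trans ?_
  rw [← mul_assoc, mul_assoc (8 * B ^ 2)]
  exact mul_le_mul_of_nonneg_left (CharTail.tailBound_le hq) (by positivity)
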